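/- Let $0<\sigma<1$. For $l>0$ and an integer $n\ge 1$ let $x_0=0$, $x_i=\sigma^{n-i}l$ ($1\le i\le n$) be the geometric mesh on $[0,l]$, and for $\mathbf p\in\mathbb N_0^n$ let $\mathcal P_{\mathbf p,n}(0,l)$ be the space of functions $\rho:[0,l]\to\mathbb C$ such that $\rho|_{(x_{i-1},x_i)}$ is a polynomial of degree at most $(\mathbf p)_i$ for $i=1,\dots,n$. For $k>0$ let $$\|u\|_{H^{-1/2}_k(\mathbb R)}^2=\int_{\mathbb R}(k^2+\xi^2)^{-1/2}|\hat u(\xi)|^2\,d\xi,\qquad \hat u(\xi)=(2\pi)^{-1/2}\int_{\mathbb R}e^{-i\xi x}u(x)\,dx,$$ (with $\hat u$ extended to tempered distributions in the usual way), and let $\tilde H^{-1/2}(0,l)$ be the closure of $C_0^\infty(0,l)$ in $H^{-1/2}(\mathbb R)$, with norm $\|\cdot\|_{\tilde H^{-1/2}_k(0,l)}=\|\cdot\|_{H^{-1/2}_k(\mathbb R)}$; functions on $(0,l)$ are extended by zero to $\mathbb R$. **Theorem.** Suppose that $g$ is analytic in $\operatorname{Re} z>0$ and satisfies $|g(z)|\le\hat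 C|z|^{-1/2}$ for $\operatorname{Re} z>0$, for some $\hat C>0$. Given $k>0$, $l>0$, $\alpha\in[0,1]$ and integers $n\ge1$, $p\ge0$, let the degree vector $\mathbf p$ be defined by $$(\mathbf p)_i=p-\Big\lfloor\frac{\alpha(n+1-i)}{n}\,p\Big\rfloor\quad(1\le i\le n-1),\qquad(\mathbf p)_n=p,$$ and suppose that $n\ge cp$ for some constant $c>0$. Then $g-v\in\tilde H^{-1/2}(0,l)$ for every $v\in\mathcal P_{\mathbf p,n}(0,l)$, and for any $0<\epsilon<1/2$ there exist a constant $C>0$, depending only on $\epsilon$ and $\sigma$ (with $C\to\infty$ as $\epsilon\to0$ or $\epsilon\to1/2$), and a constant $\tau>0$, depending only on $\epsilon$, $\sigma$, $\alpha$ and $c$ (with $\tau\to0$ as $\epsilon\to0$), such that $$\inf_{v\in\mathcal P_{\mathbf p,n}(0,l)}\|g-v\|_{\tilde H^{-1/2}_k(0,l)}\le C\,\hat C\,k^{-1/2}(kl)^{\epsilon}\,e^{-p\tau}.$$ -/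

import Mathlib

open MeasureTheory Set Filter Topology
open scoped SchwartzMap FourierTransform ENNReal

noncomputable section

namespace HalfPlane

/-- The function `U` is the Fourier transform, in the convention
`û(ξ) = (2π)^(-1/2) ∫ exp(-iξx) u(x) dx`, of the tempered distribution `u` on `ℝ`.
Mathlib's transform `𝓕` uses the kernel `exp(-2πiηx)`, so that `û` and `𝓕 u` are related by
`(𝓕 u)(η) = (2π)^(1/2) û(2πη)`. -/
def IsFourierTransformOf (u : 𝓢'(ℝ, ℂ)) (U : ℝ → ℂ) : Prop :=
  ∀ ψ : 𝓢(ℝ, ℂ),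
    Integrable (fun η : ℝ => ((Real.sqrt (2 * Real.pi) : ℝ) : ℂ) * U (2 * Real.pi * η) * ψ η) ∧
      (𝓕 u) ψ = ∫ η : ℝ, ((Real.sqrt (2 * Real.pi) : ℝ) : ℂ) * U (2 * Real.pi * η) * ψ η

/-- The wavenumber-dependent norm of `H^s(ℝ)`,
`‖u‖² = ∫ (k² + ξ²)^s |û(ξ)|² dξ`, as an extended nonnegative number.
The Fourier transform `û` is unique up to null sets if it is a function; if it is not a function
the infimum is over the empty set, and the value is `∞`. -/
def sobolevNorm (k s : ℝ) (u : 𝓢'(ℝ, ℂ)) : ℝ≥0∞ :=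
  ⨅ (U : ℝ → ℂ) (_ : IsFourierTransformOf u U),
    (∫⁻ ξ : ℝ, ENNReal.ofReal ((k ^ 2 + ξ ^ 2) ^ s) * ‖U ξ‖ₑ ^ 2) ^ (1 / 2 : ℝ)

/-- `H^s(ℝ)`: the tempered distributions whose (standard, `k = 1`) Sobolev norm is finite. -/
def sobolevSpace (s : ℝ) : Set 𝓢'(ℝ, ℂ) := {u | sobolevNorm 1 s u < ∞}

/-- `H̃^s(Ω)`: the closure in `H^s(ℝ)` of the smooth functions with compact support in `Ω`.
It carries the norms `sobolevNorm k s` of `H^s(ℝ)`. -/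
def sobolevTilde (s : ℝ) (Ω : Set ℝ) : Set 𝓢'(ℝ, ℂ) :=
  {u | u ∈ sobolevSpace s ∧ ∀ δ : ℝ≥0∞, 0 < δ → ∃ φ : 𝓢(ℝ, ℂ),
    HasCompactSupport (φ : ℝ → ℂ) ∧ tsupport (φ : ℝ → ℂ) ⊆ Ω ∧
      sobolevNorm 1 s (u - (φ : 𝓢'(ℝ, ℂ))) < δ}

open scoped Classical in
/-- The tempered distribution `ψ ↦ ∫_Ω f ψ` of a function `f` that is integrable on `Ω`,
i.e. the distribution given by the extension by zero of `f|_Ω`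
(with the value `0` if `f` is not integrable on `Ω`). -/
def zeroExtension (Ω : Set ℝ) (f : ℝ → ℂ) : 𝓢'(ℝ, ℂ) :=
  if h : Integrable (Ω.indicator f) then
    Lp.toTemperedDistribution (h.toL1 (Ω.indicator f)) else 0

/-- The points `x_0 = 0`, `x_i = σ^(n-i) l` (`1 ≤ i ≤ n`) of the geometric mesh with `n` layers on
`[0, l]`. -/
def meshPoint (σ l : ℝ) (n i : ℕ) : ℝ := if i = 0 then 0 else σ ^ (n - i) * l

/-- The degree vector: `p - ⌊α (n + 1 - i) p / n⌋` for `1 ≤ i ≤ n - 1`, and `p` for `i = n`.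
For `α ∈ [0, 1]` the subtraction is never truncated. -/
def degreeVector (α : ℝ) (p n i : ℕ) : ℕ :=
  if i = n then p else p - ⌊α * ((n : ℝ) + 1 - (i : ℝ)) / (n : ℝ) * (p : ℝ)⌋₊

/-- The piecewise polynomials on the geometric mesh with `n` layers on `[0, l]`, of degree at most
`d i` on the `i`-th mesh interval `(x_{i-1}, x_i)`. The values outside `(0, l)` are irrelevant. -/
def piecewisePolynomials (σ l : ℝ) (n : ℕ) (d : ℕ → ℕ) : Set (ℝ → ℂ) :=
  {v | ∀ i ∈ Finset.Icc 1 n, ∃ P : Polynomial ℂ, P.natDegree ≤ d i ∧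
    ∀ x ∈ Ioo (meshPoint σ l n (i - 1)) (meshPoint σ l n i), v x = P.eval (x : ℂ)}

end HalfPlane

end

/-! The only obstacle is the possible singularity z^(-1/2) at 0, which just fails to be square
integrable. On the scale of its distance to 0, g is uniformly holomorphic: a mesh interval [σb, b]
sits in a disc inside the half-plane whose proportions depend on σ alone. Taylor polynomials of
degree q therefore have error O(Chat x^(-1/2) (1-σ)^q) there
(`exists_polynomial_approx_of_halfPlane`). On the interval touching 0 the approximant is zero.

Degrees may be low near 0, but there x/l is exponentially small. Weakening x^(-1/2) to l^β
x^(-1/2-β) gains a factor σ^(β(n-i)) on the i-th interval, and by `geometric_trade_off` the gains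
from mesh and degree together yield exp(-pτ) on every interval. So |g - v| ≤ M x^(-1/2-β) with M
proportional to Chat exp(-pτ) l^β (`exists_piecewisePolynomial_approx`).

Such functions are measured by `eLpNorm_fourier_le_of_bound_rpow`. A piece of size B on an interval
of length h has norm O(B k^(s-1/2) h^(s+1/2)) for 0 < s < 1/2, by an L¹ bound at low frequencies and
Plancherel at high ones. Over dyadic pieces shrinking to 0 these bounds form a convergent geometric
series when β < s. The choice s = ε, β = ε/2 gives the stated powers of k and l. -/

namespace HalfPlane

/-! ### Taylor approximation on one mesh interval -/

/-- A function that is holomorphic near a closed disc is approximated on smaller discs by its Taylor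
polynomials, with a geometric rate. -/
theorem exists_polynomial_norm_sub_le {f : ℂ → ℂ} {c : ℂ} {r R M : ℝ} (hr : 0 ≤ r) (hrR : r < R)
    (hf : DifferentiableOn ℂ f (Metric.closedBall c R))
    (hM : ∀ z ∈ Metric.sphere c R, ‖f z‖ ≤ M) (q : ℕ) :
    ∃ P : Polynomial ℂ, P.natDegree ≤ q ∧ ∀ z ∈ Metric.closedBall c r,
      ‖f z - P.eval z‖ ≤ M * (r / R) ^ q / (1 - r / R) := by
  have hR : 0 < R := hr.trans_lt hrR
  have hM0 : 0 ≤ M := (norm_nonneg _).trans (hM (c + R) (by simp [hR.le]))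
  lift R to NNReal using hR.le
  have hps := DifferentiableOn.hasFPowerSeriesOnBall hf (by exact_mod_cast hR)
  set p := cauchyPowerSeries f c R with hp
  -- Cauchy's estimate: the mean of ‖f‖ over the circle of radius R is at most M.
  have hcoeff : ∀ i, ‖p.coeff i‖ ≤ M * (R : ℝ)⁻¹ ^ i := by
    intro i
    have h1 : ‖p.coeff i‖ ≤ ‖p i‖ := by
      rw [p.norm_apply_eq_norm_coef]
    refine h1.trans ((norm_cauchyPowerSeries_le f c R i).trans ?_)
    rw [abs_of_pos hR]
    gcongr
    have h2 : ‖∫ θ : ℝ in (0 : ℝ)..2 * Real.pi, ‖f (circleMap c R θ)‖‖ ≤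
        M * |2 * Real.pi - 0| := by
      refine intervalIntegral.norm_integral_le_of_norm_le_const fun θ _ => ?_
      rw [norm_norm]
      exact hM _ (circleMap_mem_sphere c hR.le θ)
    rw [sub_zero, abs_of_pos Real.two_pi_pos] at h2
    calc _ ≤ (2 * Real.pi)⁻¹ * (M * (2 * Real.pi)) := by
            gcongr
            exact (Real.le_norm_self _).trans h2
      _ = M := by field_simp
  refine ⟨∑ i ∈ Finset.range (q + 1),
    Polynomial.C (p.coeff i) * (Polynomial.X - Polynomial.C c) ^ i, ?_, ?_⟩
  · refine Polynomial.natDegree_sum_le_of_forall_le _ _ fun i hi => ?_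
    refine (Polynomial.natDegree_C_mul_le _ _).trans ?_
    rw [Polynomial.natDegree_pow, Polynomial.natDegree_X_sub_C]
    have := Finset.mem_range.1 hi
    omega
  · intro z hz
    have hzr : ‖z - c‖ ≤ r := by rwa [Metric.mem_closedBall, dist_eq_norm] at hz
    have hsum : HasSum (fun i => (z - c) ^ i * p.coeff i) (f z) := by
      have := hps.hasSum (y := z - c) (by
        rw [mem_eball_zero_iff, ← enorm_norm]
        rw [Real.enorm_eq_ofReal (norm_nonneg _), ENNReal.ofReal_lt_coe_iff (norm_nonneg _)]
        exact hzr.trans_lt hrR)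
      simpa [FormalMultilinearSeries.apply_eq_pow_smul_coeff] using this
    have hlt : r / R < 1 := (div_lt_one hR).2 hrR
    have := norm_sub_le_of_geometric_bound_of_hasSum hlt (C := M) (fun i => ?_) hsum (q + 1)
    · rw [norm_sub_rev] at this
      rw [Polynomial.eval_finsetSum]
      simp only [Polynomial.eval_mul, Polynomial.eval_C, Polynomial.eval_pow, Polynomial.eval_sub,
        Polynomial.eval_X]
      simp_rw [mul_comm (p.coeff _)]
      refine this.trans ?_
      have h1 : 0 ≤ 1 - r / R := by linarith
      have h2 : (r / R) ^ (q + 1) ≤ (r / R) ^ q :=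
        pow_le_pow_of_le_one (by positivity) hlt.le (Nat.le_succ q)
      gcongr
    · rw [norm_mul, norm_pow]
      calc ‖z - c‖ ^ i * ‖p.coeff i‖ ≤ r ^ i * (M * (R : ℝ)⁻¹ ^ i) := by
            gcongr; exact hcoeff i
        _ = M * (r / R) ^ i := by rw [div_eq_mul_inv, mul_pow]; ring

/-- Approximation on `[σ b, b]` of a function that is holomorphic in the right half-plane and is
bounded there by `Chat |z|^(-1/2)`. -/
theorem exists_polynomial_approx_of_halfPlane {σ b Chat : ℝ} (hσ0 : 0 < σ) (hσ1 : σ < 1)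
    (hb : 0 < b) (hC : 0 ≤ Chat) {g : ℂ → ℂ} (hg : AnalyticOnNhd ℂ g {z : ℂ | 0 < z.re})
    (hgb : ∀ z : ℂ, 0 < z.re → ‖g z‖ ≤ Chat * ‖z‖ ^ (-(1 / 2) : ℝ)) (q : ℕ) :
    ∃ P : Polynomial ℂ, P.natDegree ≤ q ∧ ∀ x ∈ Icc (σ * b) b,
      ‖g (x : ℂ) - P.eval (x : ℂ)‖ ≤
        ((σ / 2) ^ (-(1 / 2) : ℝ) / σ) * Chat * x ^ (-(1 / 2) : ℝ) * (1 - σ) ^ q := by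
  -- The disc is centred at the midpoint of [σb, b]. Its radius b/2 leaves the gap σb/2 to the
  -- imaginary axis, while [σb, b] fills the concentric disc of radius (1-σ)b/2; the ratio of the
  -- radii is 1-σ.
  have hre : ∀ z ∈ Metric.closedBall (((1 + σ) * b / 2 : ℝ) : ℂ) (b / 2), σ * b / 2 ≤ z.re := by
    intro z hz
    rw [Metric.mem_closedBall, dist_eq_norm] at hz
    have h1 := (Complex.abs_re_le_norm _).trans hz
    rw [Complex.sub_re, Complex.ofReal_re] at h1
    have := neg_le_of_abs_le h1
    linarith
  have hpos : 0 < σ * b / 2 := by positivity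
  obtain ⟨P, hP, hPz⟩ := exists_polynomial_norm_sub_le (f := g)
    (c := (((1 + σ) * b / 2 : ℝ) : ℂ)) (r := (1 - σ) * b / 2) (R := b / 2)
    (M := Chat * (σ * b / 2) ^ (-(1 / 2) : ℝ)) (by have := sub_pos.2 hσ1; positivity)
    (by nlinarith)
    (fun z hz => (hg z (hpos.trans_le (hre z hz))).differentiableAt.differentiableWithinAt)
    (fun z hz => by
      have h1 := hre z (Metric.sphere_subset_closedBall hz)
      refine (hgb z (hpos.trans_le h1)).trans ?_
      refine mul_le_mul_of_nonneg_left ?_ hC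
      exact Real.rpow_le_rpow_of_nonpos hpos (h1.trans (Complex.re_le_norm z)) (by norm_num)) q
  refine ⟨P, hP, fun x hx => ?_⟩
  have hx0 : 0 < x := (mul_pos hσ0 hb).trans_le hx.1
  refine (hPz x ?_).trans ?_
  · rw [Metric.mem_closedBall, dist_eq_norm, ← Complex.ofReal_sub, Complex.norm_real,
      Real.norm_eq_abs, abs_le]
    constructor <;> nlinarith [hx.1, hx.2]
  · have h1 : (1 - σ) * b / 2 / (b / 2) = 1 - σ := by field_simp
    rw [h1, sub_sub_cancel]
    have h2 : (σ * b / 2) ^ (-(1 / 2) : ℝ) ≤ (σ / 2) ^ (-(1 / 2) : ℝ) * x ^ (-(1 / 2) : ℝ) := by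
      rw [mul_div_right_comm, Real.mul_rpow (by positivity) hb.le]
      exact mul_le_mul_of_nonneg_left (Real.rpow_le_rpow_of_nonpos hx0 hx.2 (by norm_num))
        (by positivity)
    have h3 := sub_pos.2 hσ1
    calc _ ≤ Chat * ((σ / 2) ^ (-(1 / 2) : ℝ) * x ^ (-(1 / 2) : ℝ)) * (1 - σ) ^ q / σ := by gcongr
      _ = _ := by ring

/-! ### Mesh, degrees and the piecewise approximant -/

/-- Off the mesh points, `(0, l)` is the union of the mesh intervals. -/
theorem exists_mem_meshInterval {σ l : ℝ} {n : ℕ} (hn : 1 ≤ n) {x : ℝ} (hx : x ∈ Ioo 0 l)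
    (hne : ∀ i ∈ Finset.range n, x ≠ meshPoint σ l n i) :
    ∃ i ∈ Finset.Icc 1 n, x ∈ Ioo (meshPoint σ l n (i - 1)) (meshPoint σ l n i) := by
  classical
  have hex : ∃ i, i ≤ n ∧ x < meshPoint σ l n i :=
    ⟨n, le_rfl, by simpa [meshPoint, Nat.one_le_iff_ne_zero.1 hn] using hx.2⟩
  obtain ⟨hi1, hi2⟩ := Nat.find_spec hex
  have hi0 : Nat.find hex ≠ 0 := fun h => by
    rw [h] at hi2
    simp only [meshPoint, if_true] at hi2
    exact lt_asymm hi2 hx.1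
  refine ⟨Nat.find hex, Finset.mem_Icc.2 ⟨Nat.one_le_iff_ne_zero.2 hi0, hi1⟩, ?_, hi2⟩
  have h := Nat.find_min hex (m := Nat.find hex - 1) (by omega)
  rw [not_and, not_lt] at h
  exact lt_of_le_of_ne (h (by omega)) (hne _ (Finset.mem_range.2 (by omega))).symm

theorem meshPoint_nonneg {σ l : ℝ} (hσ0 : 0 ≤ σ) (hl : 0 ≤ l) (n i : ℕ) :
    0 ≤ meshPoint σ l n i := by
  unfold meshPoint; split_ifs <;> positivity

theorem meshPoint_mono {σ l : ℝ} (hσ0 : 0 ≤ σ) (hσ1 : σ ≤ 1) (hl : 0 ≤ l) (n : ℕ) :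
    Monotone (meshPoint σ l n) := by
  intro i j hij
  by_cases hi : i = 0
  · rw [hi, meshPoint, if_pos rfl]
    exact meshPoint_nonneg hσ0 hl n j
  · rw [meshPoint, meshPoint, if_neg hi, if_neg (by omega)]
    gcongr ?_ * l
    exact pow_le_pow_of_le_one hσ0 hσ1 (by omega)

/-- The floor and the truncation of the natural subtraction both err upwards, and for i = n the
subtracted term is nonnegative. This linear bound is all that the trade-off uses about the degrees.
-/
theorem degreeVector_ge {α : ℝ} (hα : α ∈ Icc (0 : ℝ) 1) (p : ℕ) {n i : ℕ} (hi : i ≤ n)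
    (hn : 1 ≤ n) :
    (p : ℝ) * (1 - α * (((n : ℝ) + 1 - i) / n)) ≤ degreeVector α p n i := by
  have hn' : (0 : ℝ) < n := by exact_mod_cast hn
  have hi' : (i : ℝ) ≤ n := by exact_mod_cast hi
  have h0 : 0 ≤ α * ((n : ℝ) + 1 - i) / n * p := by
    have : (0 : ℝ) ≤ (n : ℝ) + 1 - i := by linarith
    have := hα.1
    positivity
  have heq : (p : ℝ) * (1 - α * (((n : ℝ) + 1 - i) / n)) = p - α * ((n : ℝ) + 1 - i) / n * p := by
    ring
  rw [heq]
  unfold degreeVector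
  split_ifs with h
  · linarith
  · have h1 := Nat.floor_le h0
    have h2 : ((p - ⌊α * ((n : ℝ) + 1 - i) / n * p⌋₊ : ℤ) : ℝ) ≤
        ((p - ⌊α * ((n : ℝ) + 1 - i) / n * p⌋₊ : ℕ) : ℝ) := by
      exact_mod_cast (by omega : (p : ℤ) - (⌊α * ((n : ℝ) + 1 - i) / n * p⌋₊ : ℤ) ≤
        ((p - ⌊α * ((n : ℝ) + 1 - i) / n * p⌋₊ : ℕ) : ℤ))
    push_cast at h2 ⊢
    linarith

/-- The trade-off between the smallness of the mesh intervals near `0` and the low polynomial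
degrees there. -/
theorem geometric_trade_off {lam γ c α p n m q τ : ℝ} (hlam : 0 ≤ lam) (hp : 0 ≤ p)
    (hα : α ∈ Icc (0 : ℝ) 1) (hn : 0 < n) (hm : 0 ≤ m) (hmn : m ≤ n) (hcp : c * p ≤ n)
    (hγ : 0 ≤ γ) (hq : p * (1 - α * (m / n)) ≤ q) (hτ0 : 0 ≤ τ) (hτγ : τ ≤ γ)
    (hτc : τ ≤ lam * c) : p * τ ≤ lam * m + γ * q := by
  have hθ0 : 0 ≤ m / n := by positivity
  have hθ1 : m / n ≤ 1 := (div_le_one hn).2 hmn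
  set θ := m / n with hθ
  have hmθ : m = n * θ := by rw [hθ]; field_simp
  -- The exponent pτ is split as pτθ + pτ(1-θ). The mesh pays for the first part, through τ ≤ λc and
  -- cp ≤ n; the degree pays for the second, through τ ≤ γ and α ≤ 1.
  have h1 : p * τ * θ ≤ lam * m := by
    rw [hmθ]
    calc p * τ * θ ≤ p * (lam * c) * θ := by gcongr
      _ = lam * (c * p * θ) := by ring
      _ ≤ lam * (n * θ) := by gcongr
  have hαθ : α * θ ≤ 1 * θ := by gcongr; exact hα.2
  have h2 : p * τ * (1 - θ) ≤ γ * q := by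
    calc p * τ * (1 - θ) ≤ p * τ * (1 - α * θ) := by
          have := mul_nonneg hp hτ0
          gcongr; linarith
      _ = τ * (p * (1 - α * θ)) := by ring
      _ ≤ γ * (p * (1 - α * θ)) := by
          have : 0 ≤ 1 - α * θ := by linarith
          gcongr
      _ ≤ γ * q := by gcongr
  linarith

/-- Pointwise error of the best piecewise polynomial approximation. -/
theorem exists_piecewisePolynomial_approx {σ α β c τ l Chat : ℝ} (hσ0 : 0 < σ) (hσ1 : σ < 1)
    (hα : α ∈ Icc (0 : ℝ) 1) (hβ : 0 ≤ β) (hτ0 : 0 ≤ τ)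
    (hτσ : τ ≤ -Real.log (1 - σ)) (hτc : τ ≤ β * -Real.log σ * c) (hl : 0 < l) (hC : 0 ≤ Chat)
    {g : ℂ → ℂ} (hg : AnalyticOnNhd ℂ g {z : ℂ | 0 < z.re})
    (hgb : ∀ z : ℂ, 0 < z.re → ‖g z‖ ≤ Chat * ‖z‖ ^ (-(1 / 2) : ℝ))
    {n p : ℕ} (hn : 1 ≤ n) (hcp : c * (p : ℝ) ≤ n) :
    ∃ v ∈ piecewisePolynomials σ l n (degreeVector α p n),
      ∀ x ∈ Ioo 0 l, (∀ i ∈ Finset.range n, x ≠ meshPoint σ l n i) →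
        ‖g (x : ℂ) - v x‖ ≤ ((σ / 2) ^ (-(1 / 2) : ℝ) / σ * σ ^ (-β)) *
          (Chat * Real.exp (-(p * τ)) * l ^ β) * x ^ (-(1 / 2) - β) := by
  classical
  have hlog : 0 ≤ -Real.log σ := by
    have := Real.log_nonpos hσ0.le hσ1.le
    linarith
  have hlog1 : 0 ≤ -Real.log (1 - σ) := by
    have := Real.log_nonpos (sub_pos.2 hσ1).le (by linarith)
    linarith
  have hn' : (0 : ℝ) < n := by exact_mod_cast hn
  -- the local approximations
  have hloc : ∀ i : ℕ, ∃ P : Polynomial ℂ, P.natDegree ≤ degreeVector α p n i ∧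
      (i ≤ 1 → P = 0) ∧ (2 ≤ i → ∀ x ∈ Icc (σ * meshPoint σ l n i) (meshPoint σ l n i),
        ‖g (x : ℂ) - P.eval (x : ℂ)‖ ≤ ((σ / 2) ^ (-(1 / 2) : ℝ) / σ) * Chat *
          x ^ (-(1 / 2) : ℝ) * (1 - σ) ^ degreeVector α p n i) := by
    intro i
    -- The first interval reaches 0, so no disc around it fits in the half-plane. The case i = 0 is
    -- a dummy.
    by_cases hi : i ≤ 1
    · exact ⟨0, by simp, fun _ => rfl, fun h => by omega⟩
    · obtain ⟨P, hP, hPx⟩ := exists_polynomial_approx_of_halfPlane hσ0 hσ1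
        (b := meshPoint σ l n i) (by rw [meshPoint, if_neg (by omega)]; positivity) hC hg hgb
        (degreeVector α p n i)
      exact ⟨P, hP, fun h => absurd h hi, fun _ => hPx⟩
  choose P hPdeg hP1 hP2 using hloc
  -- Selects the mesh interval containing x; the default 0 only occurs to the right of the mesh.
  let idx : ℝ → ℕ := fun x => if h : ∃ i, x < meshPoint σ l n i then Nat.find h else 0
  have hidx : ∀ i, 1 ≤ i → ∀ x ∈ Ioo (meshPoint σ l n (i - 1)) (meshPoint σ l n i),
      idx x = i := by
    intro i hi x hx
    have hex : ∃ i, x < meshPoint σ l n i := ⟨i, hx.2⟩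
    simp only [idx, dif_pos hex]
    rw [Nat.find_eq_iff]
    refine ⟨hx.2, fun m hm => not_lt.2 (hx.1.le.trans' ?_)⟩
    exact meshPoint_mono hσ0.le hσ1.le hl.le n (by omega)
  refine ⟨fun x => (P (idx x)).eval (x : ℂ), ?_, ?_⟩
  · intro i hi
    exact ⟨P i, hPdeg i, fun x hx => by
      simp only [hidx i (Finset.mem_Icc.1 hi).1 x hx]⟩
  · intro x hx hne
    obtain ⟨i, hi, hxi⟩ := exists_mem_meshInterval hn hx hne
    obtain ⟨hi1, hin⟩ := Finset.mem_Icc.1 hi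
    simp only [hidx i hi1 x hxi]
    have hx0 : 0 < x := hx.1
    have hmi : meshPoint σ l n i = σ ^ (n - i) * l := by rw [meshPoint, if_neg (by omega)]
    have hxle : x ≤ σ ^ (n - i) * l := hmi ▸ hxi.2.le
    set K := (σ / 2) ^ (-(1 / 2) : ℝ) / σ with hK
    have hK1 : 1 ≤ K := by
      rw [hK, one_le_div hσ0]
      refine hσ1.le.trans (Real.one_le_rpow_of_pos_of_le_one_of_nonpos (by positivity)
        (by linarith) (by norm_num))
    have hcast : ((n - i : ℕ) : ℝ) = n - i := Nat.cast_sub hin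
    have hi' : (i : ℝ) ≤ n := by exact_mod_cast hin
    have hlam : 0 ≤ β * -Real.log σ := by positivity
    -- On the i-th interval l/x ≥ σ^(-(n-i)). The extra σ^(-β) raises the exponent from n-i to
    -- n+1-i, the quantity that enters the degree vector.
    have hmesh : Real.exp (β * -Real.log σ * ((n : ℝ) + 1 - i)) ≤
        σ ^ (-β) * (l ^ β * x ^ (-β)) := by
      have h1 : (σ ^ (n - i) * l) ^ (-β) ≤ x ^ (-β) :=
        Real.rpow_le_rpow_of_nonpos hx0 hxle (by linarith)
      calc Real.exp (β * -Real.log σ * ((n : ℝ) + 1 - i))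
          = σ ^ (-β) * (l ^ β * (σ ^ (n - i) * l) ^ (-β)) := by
            rw [Real.mul_rpow (by positivity) hl.le, ← Real.rpow_natCast, ← Real.rpow_mul hσ0.le,
              Real.rpow_neg hl.le, mul_left_comm (l ^ β),
              mul_inv_cancel₀ (Real.rpow_pos_of_pos hl β).ne', mul_one, ← Real.rpow_add hσ0,
              Real.rpow_def_of_pos hσ0, hcast]
            congr 1; ring
        _ ≤ _ := by gcongr
    have hsplit : x ^ (-(1 / 2) - β) = x ^ (-(1 / 2) : ℝ) * x ^ (-β) := by
      rw [← Real.rpow_add hx0]; congr 1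
    have hgoal : ∀ E : ℝ, E ≤ Real.exp (-(p * τ)) * (σ ^ (-β) * (l ^ β * x ^ (-β))) →
        K * Chat * x ^ (-(1 / 2) : ℝ) * E ≤
          K * σ ^ (-β) * (Chat * Real.exp (-(p * τ)) * l ^ β) * x ^ (-(1 / 2) - β) := by
      intro E hE
      calc K * Chat * x ^ (-(1 / 2) : ℝ) * E ≤ K * Chat * x ^ (-(1 / 2) : ℝ) *
          (Real.exp (-(p * τ)) * (σ ^ (-β) * (l ^ β * x ^ (-β)))) := by gcongr
        _ = _ := by rw [hsplit]; ring
    rcases Nat.lt_or_ge 1 i with hi2 | hi2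
    · refine (hP2 i hi2 x ⟨?_, hxi.2.le⟩).trans (hgoal _ ?_)
      -- For i ≥ 2 the left endpoint of the interval is exactly σ times the right one.
      · refine le_trans (le_of_eq ?_) hxi.1.le
        rw [hmi, meshPoint, if_neg (by omega), show n - (i - 1) = n - i + 1 by omega, pow_succ]
        ring
      · have htr := geometric_trade_off (m := (n : ℝ) + 1 - i) hlam (Nat.cast_nonneg p) hα hn'
          (by linarith) (by have : (1 : ℝ) ≤ i := by exact_mod_cast hi1
                            linarith) hcp hlog1 (degreeVector_ge hα p hin hn) hτ0 hτσ hτc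
        calc (1 - σ) ^ degreeVector α p n i
            = Real.exp (Real.log (1 - σ) * degreeVector α p n i) := by
              rw [← Real.rpow_natCast, Real.rpow_def_of_pos (sub_pos.2 hσ1)]
          _ ≤ Real.exp (-(p * τ)) * Real.exp (β * -Real.log σ * ((n : ℝ) + 1 - i)) := by
              rw [← Real.exp_add, Real.exp_le_exp]
              linarith
          _ ≤ _ := by gcongr
    · rw [hP1 i hi2, Polynomial.eval_zero, sub_zero]
      have h1 : ‖g x‖ ≤ Chat * x ^ (-(1 / 2) : ℝ) := by
        simpa [abs_of_pos hx0] using hgb x (by simpa using hx0)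
      have h2 : Chat * x ^ (-(1 / 2) : ℝ) ≤ K * Chat * x ^ (-(1 / 2) : ℝ) * 1 := by
        rw [mul_one, mul_assoc]
        exact le_mul_of_one_le_left (by positivity) hK1
      refine h1.trans (h2.trans (hgoal 1 ?_))
      have hi1' : i = 1 := by omega
      -- With no help from the degree, the mesh alone pays for the decay: pτ ≤ λcp ≤ λn, where λ =
      -- -β log σ.
      calc (1 : ℝ) ≤ Real.exp (-(p * τ)) * Real.exp (β * -Real.log σ * ((n : ℝ) + 1 - i)) := by
            rw [← Real.exp_add, Real.one_le_exp_iff, hi1']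
            have h3 : p * τ ≤ p * (β * -Real.log σ * c) := by gcongr
            have h4 : β * -Real.log σ * (c * p) ≤ β * -Real.log σ * n := by gcongr
            push_cast
            linarith
        _ ≤ _ := by gcongr

/-! ### The Sobolev norm on the Fourier side -/

/-- The measure with the density `(k² + ξ²)^s` of the Sobolev norm, in the variable `η = ξ / 2π`. -/
noncomputable def sobolevMeasure (k s : ℝ) : Measure ℝ :=
  volume.withDensity fun η => ENNReal.ofReal ((k ^ 2 + (2 * Real.pi * η) ^ 2) ^ s)

theorem measurable_sobolevWeight (k s : ℝ) :
    Measurable fun η : ℝ => ENNReal.ofReal ((k ^ 2 + (2 * Real.pi * η) ^ 2) ^ s) := by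
  fun_prop

theorem eLpNorm_two_sobolevMeasure (k s : ℝ) (F : ℝ → ℂ) :
    eLpNorm F 2 (sobolevMeasure k s) =
      (∫⁻ η, ENNReal.ofReal ((k ^ 2 + (2 * Real.pi * η) ^ 2) ^ s) * ‖F η‖ₑ ^ 2) ^ (1 / 2 : ℝ) := by
  rw [eLpNorm_eq_lintegral_rpow_enorm_toReal (by norm_num) (by norm_num), sobolevMeasure,
    lintegral_withDensity_eq_lintegral_mul_non_measurable _ (measurable_sobolevWeight k s)
      (ae_of_all _ fun _ => ENNReal.ofReal_lt_top)]
  simp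

theorem integral_fourier_smul_eq_integral_smul_fourier {f : ℝ → ℂ} (hf : Integrable f)
    (ψ : 𝓢(ℝ, ℂ)) : ∫ x, (𝓕 ψ) x • f x = ∫ η, ψ η • 𝓕 f η := by
  have h := VectorFourier.integral_fourierIntegral_smul_eq_flip (μ := volume) (ν := volume)
    (L := innerₗ ℝ) Real.continuous_fourierChar continuous_inner ψ.integrable hf
  rw [SchwartzMap.fourier_coe]
  simpa using! h

theorem continuous_fourier {f : ℝ → ℂ} (hf : Integrable f) : Continuous (𝓕 f) :=
  VectorFourier.fourierIntegral_continuous Real.continuous_fourierChar continuous_inner hf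

theorem norm_fourier_le_integral (f : ℝ → ℂ) (η : ℝ) : ‖𝓕 f η‖ ≤ ∫ x, ‖f x‖ :=
  VectorFourier.norm_fourierIntegral_le_integral_norm _ _ _ _ _

theorem isFourierTransformOf_of_integrable {f : ℝ → ℂ} (hf : Integrable f) {u : 𝓢'(ℝ, ℂ)}
    (hu : ∀ ψ : 𝓢(ℝ, ℂ), u ψ = ∫ x, ψ x • f x) :
    IsFourierTransformOf u
      fun ξ => ((Real.sqrt (2 * Real.pi) : ℝ) : ℂ)⁻¹ * 𝓕 f (ξ / (2 * Real.pi)) := by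
  intro ψ
  have h0 : ((Real.sqrt (2 * Real.pi) : ℝ) : ℂ) ≠ 0 := by
    have := Real.two_pi_pos
    exact_mod_cast (Real.sqrt_pos.2 this).ne'
  have h1 : ∀ η : ℝ, ((Real.sqrt (2 * Real.pi) : ℝ) : ℂ) * (((Real.sqrt (2 * Real.pi) : ℝ) : ℂ)⁻¹ *
      𝓕 f (2 * Real.pi * η / (2 * Real.pi))) * ψ η = 𝓕 f η * ψ η := by
    intro η
    rw [mul_inv_cancel_left₀ h0, mul_div_cancel_left₀ _ Real.two_pi_pos.ne']
  simp_rw [h1]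
  refine ⟨ψ.integrable.bdd_mul (continuous_fourier hf).aestronglyMeasurable
    (ae_of_all _ (norm_fourier_le_integral f)), ?_⟩
  rw [TemperedDistribution.fourier_apply, hu, integral_fourier_smul_eq_integral_smul_fourier hf]
  simp_rw [smul_eq_mul, mul_comm]

/-- The infimum defining `sobolevNorm` is tested with the explicit transform of f. Under ξ = 2πη the
Jacobian cancels the square of the normalising factor (2π)^(-1/2). -/
theorem sobolevNorm_le_eLpNorm_fourier {f : ℝ → ℂ} (hf : Integrable f) {u : 𝓢'(ℝ, ℂ)}
    (hu : ∀ ψ : 𝓢(ℝ, ℂ), u ψ = ∫ x, ψ x • f x) (k s : ℝ) :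
    sobolevNorm k s u ≤ eLpNorm (𝓕 f) 2 (sobolevMeasure k s) := by
  refine (iInf₂_le _ (isFourierTransformOf_of_integrable hf hu)).trans (le_of_eq ?_)
  rw [eLpNorm_two_sobolevMeasure]
  congr 1
  have hpi := Real.two_pi_pos
  conv_lhs => rw [← Real.smul_map_volume_mul_left hpi.ne', lintegral_smul_measure]
  have hemb : MeasurableEmbedding fun y : ℝ => 2 * Real.pi * y :=
    (Homeomorph.mulLeft₀ _ hpi.ne').measurableEmbedding
  rw [hemb.lintegral_map, smul_eq_mul, ← lintegral_const_mul' _ _ ENNReal.ofReal_ne_top]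
  refine lintegral_congr fun η => ?_
  have h2 : ENNReal.ofReal |2 * Real.pi| * ‖((Real.sqrt (2 * Real.pi) : ℝ) : ℂ)⁻¹‖ₑ ^ 2 = 1 := by
    rw [← ofReal_norm, ← ENNReal.ofReal_pow (norm_nonneg _), ← ENNReal.ofReal_mul (abs_nonneg _),
      norm_inv, Complex.norm_real, inv_pow, Real.norm_eq_abs, sq_abs, Real.sq_sqrt hpi.le,
      abs_of_pos hpi, mul_inv_cancel₀ hpi.ne', ENNReal.ofReal_one]
  dsimp only
  rw [mul_div_cancel_left₀ _ hpi.ne', enorm_mul, mul_pow ‖_‖ₑ, mul_left_comm, ← mul_assoc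
    (ENNReal.ofReal |2 * Real.pi|), h2, one_mul]

/-- Plancherel's theorem for the Fourier integral. -/
theorem eLpNorm_fourier_eq {f : ℝ → ℂ} (hf : Integrable f) (hf2 : MemLp f 2) :
    eLpNorm (𝓕 f) 2 volume = eLpNorm f 2 volume := by
  set F : Lp ℂ 2 (volume : Measure ℝ) := hf2.toLp f with hF
  -- The L² transform of the class of f and the Fourier integral of f agree almost everywhere,
  -- because both have the same pairing with test functions. The isometry on L² then applies.
  have hae : ∀ᵐ η, (𝓕 F : Lp ℂ 2 (volume : Measure ℝ)) η = 𝓕 f η := by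
    refine ae_eq_of_integral_contDiff_smul_eq
      ((Lp.memLp _).locallyIntegrable (by norm_num))
      (continuous_fourier hf).locallyIntegrable fun g hg hgc => ?_
    have hg₁ : HasCompactSupport (Complex.ofRealCLM ∘ g) := hgc.comp_left rfl
    have hg₂ : ContDiff ℝ (⊤ : ℕ∞) (Complex.ofRealCLM ∘ g) := by fun_prop
    set ψ : 𝓢(ℝ, ℂ) := hg₁.toSchwartzMap hg₂ with hψ
    have hψg : ∀ x, ψ x = (g x : ℂ) := fun x => rfl
    calc ∫ x, g x • (𝓕 F : Lp ℂ 2 (volume : Measure ℝ)) x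
        = ∫ x, ψ x • (𝓕 F : Lp ℂ 2 (volume : Measure ℝ)) x := by simp [hψg]
      _ = (Lp.toTemperedDistribution F) (𝓕 ψ) := by
          rw [← Lp.toTemperedDistribution_apply, ← Lp.fourier_toTemperedDistribution_eq,
            TemperedDistribution.fourier_apply]
      _ = ∫ x, (𝓕 ψ) x • f x := by
          rw [Lp.toTemperedDistribution_apply]
          refine integral_congr_ae ?_
          filter_upwards [hf2.coeFn_toLp] with x hx
          rw [hF, hx]
      _ = ∫ x, ψ x • 𝓕 f x := integral_fourier_smul_eq_integral_smul_fourier hf ψ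
      _ = ∫ x, g x • 𝓕 f x := by simp [hψg]
  have h2 := Lp.norm_fourier_eq F
  rw [← eLpNorm_congr_ae hae, ← eLpNorm_congr_ae hf2.coeFn_toLp, ← hF, ← Lp.enorm_def,
    ← Lp.enorm_def, ← ofReal_norm, ← ofReal_norm, h2]

/-- Minkowski's inequality for partial sums, passed to the limit by monotone convergence of their
squares. -/
theorem eLpNorm_le_tsum_eLpNorm {α E : Type*} [MeasurableSpace α] {μ : Measure α}
    [NormedAddCommGroup E] {F : α → E} {G : ℕ → α → E}
    (hG : ∀ j, AEStronglyMeasurable (G j) μ) (hF : ∀ᵐ x ∂μ, ‖F x‖ₑ ≤ ∑' j, ‖G j x‖ₑ) :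
    eLpNorm F 2 μ ≤ ∑' j, eLpNorm (G j) 2 μ := by
  have hmeas : ∀ n : ℕ, AEMeasurable (fun x => ∑ j ∈ Finset.range n, ‖G j x‖ₑ) μ := fun n =>
    Finset.aemeasurable_fun_sum _ fun j _ => (hG j).enorm
  have hfin : ∀ n : ℕ, eLpNorm (fun x => ∑ j ∈ Finset.range n, ‖G j x‖ₑ) 2 μ ≤
      ∑' j, eLpNorm (G j) 2 μ := by
    intro n
    have h := eLpNorm_sum_le (μ := μ) (p := 2) (s := Finset.range n)
      (f := fun j x => ‖G j x‖ₑ) (fun j _ => (hG j).enorm.aestronglyMeasurable) (by norm_num)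
    rw [show (∑ j ∈ Finset.range n, fun x => ‖G j x‖ₑ) =
      fun x => ∑ j ∈ Finset.range n, ‖G j x‖ₑ from by ext x; simp] at h
    refine h.trans ((Finset.sum_le_sum fun j _ => ?_).trans (ENNReal.sum_le_tsum (Finset.range n)))
    rw [eLpNorm_enorm]
  have hconv := lintegral_tendsto_of_tendsto_of_monotone (μ := μ)
    (f := fun n x => (∑ j ∈ Finset.range n, ‖G j x‖ₑ) ^ 2)
    (F := fun x => (∑' j, ‖G j x‖ₑ) ^ 2) (fun n => (hmeas n).pow_const 2)
    (ae_of_all _ fun x => fun a b hab => by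
      dsimp only
      gcongr)
    (ae_of_all _ fun x => ENNReal.Tendsto.pow (ENNReal.tendsto_nat_tsum _))
  have hT : ∀ n : ℕ, ∫⁻ x, (∑ j ∈ Finset.range n, ‖G j x‖ₑ) ^ 2 ∂μ ≤
      (∑' j, eLpNorm (G j) 2 μ) ^ 2 := by
    intro n
    have h := hfin n
    rw [eLpNorm_eq_lintegral_rpow_enorm_toReal (by norm_num) (by norm_num)] at h
    have h' := ENNReal.rpow_le_rpow h (z := 2) (by norm_num)
    rw [← ENNReal.rpow_mul] at h'
    simpa using h'
  have hlim := le_of_tendsto' hconv hT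
  rw [eLpNorm_eq_lintegral_rpow_enorm_toReal (by norm_num) (by norm_num)]
  have h1 : ∫⁻ x, ‖F x‖ₑ ^ (2 : ℝ≥0∞).toReal ∂μ ≤ (∑' j, eLpNorm (G j) 2 μ) ^ (2 : ℝ) := by
    rw [ENNReal.rpow_ofNat]
    refine le_trans (lintegral_mono_ae ?_) hlim
    filter_upwards [hF] with x hx
    simp only [ENNReal.toReal_ofNat, ENNReal.rpow_ofNat]
    gcongr
  calc _ ≤ ((∑' j, eLpNorm (G j) 2 μ) ^ (2 : ℝ)) ^ (1 / (2 : ℝ≥0∞).toReal) := by gcongr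
    _ = _ := by rw [← ENNReal.rpow_mul]; simp

/-! ### Splitting low and high frequencies -/

theorem setLIntegral_Ioo_rpow {a r : ℝ} (ha : 0 ≤ a) (hr : -1 < r) :
    ∫⁻ x in Ioo 0 a, ENNReal.ofReal (x ^ r) = ENNReal.ofReal (a ^ (r + 1) / (r + 1)) := by
  have hint : IntegrableOn (fun x : ℝ => x ^ r) (Ioo 0 a) := by
    have := (intervalIntegral.intervalIntegrable_rpow' hr (a := 0) (b := a)).1
    exact this.mono_set Ioo_subset_Ioc_self
  rw [← ofReal_integral_eq_lintegral_ofReal hint]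
  · rw [← integral_Ioc_eq_integral_Ioo, ← intervalIntegral.integral_of_le ha,
      integral_rpow (Or.inl hr), Real.zero_rpow (by linarith), sub_zero]
  · filter_upwards [ae_restrict_mem measurableSet_Ioo] with x hx
    exact Real.rpow_nonneg hx.1.le r

theorem setLIntegral_abs_rpow_le {a r : ℝ} (ha : 0 ≤ a) (hr : -1 < r) :
    ∫⁻ x in Ioo (-a) a, ENNReal.ofReal (|x| ^ r) ≤
      2 * ENNReal.ofReal (a ^ (r + 1) / (r + 1)) := by
  have hpos : ∫⁻ x in Ioo 0 a, ENNReal.ofReal (|x| ^ r) =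
      ENNReal.ofReal (a ^ (r + 1) / (r + 1)) := by
    rw [← setLIntegral_Ioo_rpow ha hr]
    exact setLIntegral_congr_fun measurableSet_Ioo fun x hx => by simp [abs_of_pos hx.1]
  have hneg : ∫⁻ x in Ioo (-a) 0, ENNReal.ofReal (|x| ^ r) =
      ENNReal.ofReal (a ^ (r + 1) / (r + 1)) := by
    rw [← hpos]
    have h := (Measure.measurePreserving_neg (volume : Measure ℝ)).setLIntegral_comp_preimage_emb
      (Homeomorph.neg ℝ).measurableEmbedding (fun x => ENNReal.ofReal (|x| ^ r)) (Ioo 0 a)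
    rw [← h]
    simp
  have hsub : Ioo (-a) a ⊆ (Ioo (-a) 0 ∪ Ioo 0 a) ∪ {0} := by
    intro x hx
    rcases lt_trichotomy x 0 with h | h | h
    · exact Or.inl (Or.inl ⟨hx.1, h⟩)
    · exact Or.inr h
    · exact Or.inl (Or.inr ⟨h, hx.2⟩)
  calc _ ≤ ∫⁻ x in (Ioo (-a) 0 ∪ Ioo 0 a) ∪ {0}, ENNReal.ofReal (|x| ^ r) :=
        lintegral_mono_set hsub
    _ ≤ ((∫⁻ x in Ioo (-a) 0, ENNReal.ofReal (|x| ^ r)) +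
          ∫⁻ x in Ioo 0 a, ENNReal.ofReal (|x| ^ r)) + ∫⁻ x in {0}, ENNReal.ofReal (|x| ^ r) :=
        (lintegral_union_le _ _ _).trans (add_le_add (lintegral_union_le _ _ _) le_rfl)
    _ = _ := by rw [hneg, hpos]; simp [two_mul]

/-- The exponent -1/2 is split into (2s-1)/2 and -s, both nonpositive; in the first factor only k²
is kept, in the second only the frequency. -/
theorem sobolevWeight_le {k s η : ℝ} (hk : 0 < k) (hs0 : 0 ≤ s) (hs1 : s ≤ 1 / 2) (hη : η ≠ 0) :
    (k ^ 2 + (2 * Real.pi * η) ^ 2) ^ (-(1 / 2) : ℝ) ≤ k ^ (2 * s - 1) * |η| ^ (-(2 * s)) := by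
  have hη' := abs_pos.2 hη
  have h1 : |η| ^ 2 ≤ (2 * Real.pi * η) ^ 2 := by
    rw [mul_pow, ← sq_abs η]
    exact le_mul_of_one_le_left (by positivity) (one_le_pow₀ (by nlinarith [Real.pi_gt_three]))
  have h2 : 0 < k ^ 2 + (2 * Real.pi * η) ^ 2 := by positivity
  calc _ = (k ^ 2 + (2 * Real.pi * η) ^ 2) ^ ((2 * s - 1) / 2) *
        (k ^ 2 + (2 * Real.pi * η) ^ 2) ^ (-(2 * s) / 2) := by
        rw [← Real.rpow_add h2]; congr 1; ring
    _ ≤ (k ^ 2) ^ ((2 * s - 1) / 2) * (|η| ^ 2) ^ (-(2 * s) / 2) := by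
        gcongr ?_ * ?_
        · exact Real.rpow_le_rpow_of_nonpos (by positivity) (by nlinarith) (by linarith)
        · exact Real.rpow_le_rpow_of_nonpos (by positivity) (by nlinarith) (by linarith)
    _ = _ := by
        rw [← Real.rpow_natCast, ← Real.rpow_mul hk.le, ← Real.rpow_natCast,
          ← Real.rpow_mul hη'.le]
        congr 2 <;> push_cast <;> ring

theorem eLpNorm_sobolevMeasure_le_eLpNorm (F : ℝ → ℂ) :
    eLpNorm F 2 (sobolevMeasure 1 (-(1 / 2))) ≤ eLpNorm F 2 volume := by
  refine eLpNorm_mono_measure _ ?_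
  conv_rhs => rw [← withDensity_one (μ := (volume : Measure ℝ))]
  refine withDensity_mono (ae_of_all _ fun η => ?_)
  rw [Pi.one_apply, ENNReal.ofReal_le_one]
  exact Real.rpow_le_one_of_one_le_of_nonpos (by nlinarith [sq_nonneg (2 * Real.pi * η)])
    (by norm_num)

/-- The frequencies are split at |η| = 1/h. Below, |𝓕 f| is at most the L¹ norm and |η|^(-2s) is
integrable at 0 since 2s < 1. Above, |η|^(-2s) ≤ h^(2s) and Plancherel applies. Both parts scale as
A² h^(2s). -/
theorem eLpNorm_fourier_sobolevMeasure_le {f : ℝ → ℂ} {k s h A : ℝ} (hf : Integrable f)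
    (hf2 : MemLp f 2) (hk : 0 < k) (hs0 : 0 < s) (hs1 : s < 1 / 2) (hh : 0 < h) (hA : 0 ≤ A)
    (h1 : ∫ x, ‖f x‖ ≤ A * h ^ (1 / 2 : ℝ)) (h2 : eLpNorm f 2 volume ≤ ENNReal.ofReal A) :
    eLpNorm (𝓕 f) 2 (sobolevMeasure k (-(1 / 2))) ≤
      ENNReal.ofReal (Real.sqrt (1 + 2 / (1 - 2 * s)) * A * k ^ (s - 1 / 2) * h ^ s) := by
  have hs2 : 0 < 1 - 2 * s := by linarith
  have hpt : ∀ᵐ η : ℝ, ENNReal.ofReal ((k ^ 2 + (2 * Real.pi * η) ^ 2) ^ (-(1 / 2) : ℝ)) *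
      ‖𝓕 f η‖ₑ ^ 2 ≤ ENNReal.ofReal (k ^ (2 * s - 1)) *
        (ENNReal.ofReal (A ^ 2 * h) *
          (Ioo (-h⁻¹) h⁻¹).indicator (fun η => ENNReal.ofReal (|η| ^ (-(2 * s)))) η +
        ENNReal.ofReal (h ^ (2 * s)) * ‖𝓕 f η‖ₑ ^ 2) := by
    have h0 : ∀ᵐ η : ℝ, η ≠ 0 := by simp [ae_iff]
    filter_upwards [h0] with η hη
    have hw : ENNReal.ofReal ((k ^ 2 + (2 * Real.pi * η) ^ 2) ^ (-(1 / 2) : ℝ)) ≤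
        ENNReal.ofReal (k ^ (2 * s - 1)) * ENNReal.ofReal (|η| ^ (-(2 * s))) := by
      rw [← ENNReal.ofReal_mul (by positivity)]
      exact ENNReal.ofReal_le_ofReal (sobolevWeight_le hk hs0.le hs1.le hη)
    refine (mul_le_mul_left hw _).trans ?_
    rw [mul_assoc]
    gcongr
    by_cases hm : η ∈ Ioo (-h⁻¹) h⁻¹
    · rw [indicator_of_mem hm, mul_comm]
      refine le_add_right ?_
      gcongr
      rw [← ofReal_norm, ← ENNReal.ofReal_pow (norm_nonneg _)]
      refine ENNReal.ofReal_le_ofReal ?_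
      calc ‖𝓕 f η‖ ^ 2 ≤ (A * h ^ (1 / 2 : ℝ)) ^ 2 := by
            gcongr
            exact (norm_fourier_le_integral f η).trans h1
        _ = A ^ 2 * h := by
            rw [mul_pow, ← Real.rpow_natCast (h ^ (1 / 2 : ℝ)), ← Real.rpow_mul hh.le]
            norm_num
    · rw [indicator_of_notMem hm, mul_zero, zero_add]
      gcongr
      have habs : h⁻¹ ≤ |η| := by
        by_contra hlt
        exact hm (abs_lt.1 (not_le.1 hlt))
      calc |η| ^ (-(2 * s)) ≤ h⁻¹ ^ (-(2 * s)) :=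
            Real.rpow_le_rpow_of_nonpos (by positivity) habs (by linarith)
        _ = h ^ (2 * s) := by
            rw [Real.inv_rpow hh.le, Real.rpow_neg hh.le, inv_inv]
  have hL2 : ∫⁻ η, ‖𝓕 f η‖ₑ ^ 2 ≤ ENNReal.ofReal (A ^ 2) := by
    have h3 : eLpNorm (𝓕 f) 2 volume ≤ ENNReal.ofReal A := (eLpNorm_fourier_eq hf hf2).trans_le h2
    rw [eLpNorm_eq_lintegral_rpow_enorm_toReal (by norm_num) (by norm_num)] at h3
    have h4 := ENNReal.rpow_le_rpow h3 (z := 2) (by norm_num)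
    rw [← ENNReal.rpow_mul] at h4
    rw [ENNReal.ofReal_pow hA]
    simpa using h4
  have hlow : ∫⁻ η, (Ioo (-h⁻¹) h⁻¹).indicator (fun η => ENNReal.ofReal (|η| ^ (-(2 * s)))) η ≤
      ENNReal.ofReal (2 / (1 - 2 * s) * h ^ (2 * s - 1)) := by
    rw [lintegral_indicator measurableSet_Ioo]
    refine (setLIntegral_abs_rpow_le (by positivity) (by linarith)).trans (le_of_eq ?_)
    rw [← ENNReal.ofReal_ofNat, ← ENNReal.ofReal_mul (by norm_num), Real.inv_rpow hh.le,
      ← Real.rpow_neg hh.le]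
    congr 1
    rw [show -(-(2 * s) + 1) = 2 * s - 1 by ring, show -(2 * s) + 1 = 1 - 2 * s by ring]
    ring
  rw [eLpNorm_two_sobolevMeasure]
  have htot : ∫⁻ η, ENNReal.ofReal ((k ^ 2 + (2 * Real.pi * η) ^ 2) ^ (-(1 / 2) : ℝ)) *
      ‖𝓕 f η‖ₑ ^ 2 ≤ ENNReal.ofReal
        ((Real.sqrt (1 + 2 / (1 - 2 * s)) * A * k ^ (s - 1 / 2) * h ^ s) ^ (2 : ℝ)) := by
    refine (lintegral_mono_ae hpt).trans ?_
    rw [lintegral_const_mul' _ _ ENNReal.ofReal_ne_top, lintegral_add_left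
      (((by fun_prop : Measurable fun η : ℝ => ENNReal.ofReal (|η| ^ (-(2 * s)))).indicator
        measurableSet_Ioo).const_mul _), lintegral_const_mul' _ _ ENNReal.ofReal_ne_top,
      lintegral_const_mul' _ _ ENNReal.ofReal_ne_top]
    calc _ ≤ ENNReal.ofReal (k ^ (2 * s - 1)) * (ENNReal.ofReal (A ^ 2 * h) *
          ENNReal.ofReal (2 / (1 - 2 * s) * h ^ (2 * s - 1)) +
          ENNReal.ofReal (h ^ (2 * s)) * ENNReal.ofReal (A ^ 2)) := by gcongr
      _ = _ := by
        rw [← ENNReal.ofReal_mul (by positivity), ← ENNReal.ofReal_mul (by positivity),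
          ← ENNReal.ofReal_add (by positivity) (by positivity),
          ← ENNReal.ofReal_mul (by positivity)]
        congr 1
        have e1 : h * h ^ (2 * s - 1) = h ^ (2 * s) := by
          rw [← Real.rpow_one_add' hh.le (by linarith)]; congr 1; ring
        have e2 : (h ^ s) ^ 2 = h ^ (2 * s) := by
          rw [← Real.rpow_natCast, ← Real.rpow_mul hh.le]; congr 1; push_cast; ring
        have e3 : (k ^ (s - 1 / 2)) ^ 2 = k ^ (2 * s - 1) := by
          rw [← Real.rpow_natCast, ← Real.rpow_mul hk.le]; congr 1; push_cast; ring
        rw [Real.rpow_ofNat, mul_pow, mul_pow, mul_pow, Real.sq_sqrt (by positivity), e2, e3,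
          ← e1]
        ring
  calc _ ≤ (ENNReal.ofReal ((Real.sqrt (1 + 2 / (1 - 2 * s)) * A * k ^ (s - 1 / 2) * h ^ s) ^
        (2 : ℝ))) ^ (1 / 2 : ℝ) := by gcongr
    _ = _ := by
      rw [← ENNReal.ofReal_rpow_of_nonneg (by positivity) (by norm_num), ← ENNReal.rpow_mul]
      norm_num

theorem memLp_indicator_of_bound {f : ℝ → ℂ} {a b B : ℝ} (hf : AEStronglyMeasurable f)
    (hB : ∀ᵐ x, x ∈ Ioc a b → ‖f x‖ ≤ B) (p : ℝ≥0∞) : MemLp ((Ioc a b).indicator f) p := by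
  rw [memLp_indicator_iff_restrict measurableSet_Ioc]
  exact MemLp.of_bound hf.restrict B ((ae_restrict_iff' measurableSet_Ioc).2 hB)

/-- The Sobolev norm of a bounded function that is supported in an interval of length `h`. -/
theorem eLpNorm_fourier_indicator_le {f : ℝ → ℂ} {k s a h B : ℝ} (hf : AEStronglyMeasurable f)
    (hk : 0 < k) (hs0 : 0 < s) (hs1 : s < 1 / 2) (hh : 0 < h) (hB0 : 0 ≤ B)
    (hB : ∀ᵐ x, x ∈ Ioc a (a + h) → ‖f x‖ ≤ B) :
    eLpNorm (𝓕 ((Ioc a (a + h)).indicator f)) 2 (sobolevMeasure k (-(1 / 2))) ≤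
      ENNReal.ofReal (Real.sqrt (1 + 2 / (1 - 2 * s)) * B * k ^ (s - 1 / 2) *
        h ^ (s + 1 / 2)) := by
  have hbd := (ae_restrict_iff' measurableSet_Ioc).2 hB
  have h12 : h ^ (1 / 2 : ℝ) * h ^ (1 / 2 : ℝ) = h := by
    rw [← Real.rpow_add hh]; norm_num
  have h1 : ∫ x, ‖(Ioc a (a + h)).indicator f x‖ ≤ (B * h ^ (1 / 2 : ℝ)) * h ^ (1 / 2 : ℝ) := by
    simp_rw [norm_indicator_eq_indicator_norm]
    rw [integral_indicator measurableSet_Ioc, mul_assoc, h12]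
    have h2 := norm_setIntegral_le_of_norm_le_const_ae' (μ := volume) (s := Ioc a (a + h))
      (f := fun x => ‖f x‖) (C := B) (by simp) (by simpa using hB)
    rw [Real.volume_real_Ioc_of_le (by linarith), add_sub_cancel_left] at h2
    exact (Real.le_norm_self _).trans h2
  have h2 : eLpNorm ((Ioc a (a + h)).indicator f) 2 volume ≤
      ENNReal.ofReal (B * h ^ (1 / 2 : ℝ)) := by
    rw [eLpNorm_indicator_eq_eLpNorm_restrict measurableSet_Ioc]
    refine (eLpNorm_le_of_ae_bound hbd).trans (le_of_eq ?_)
    rw [Measure.restrict_apply_univ, Real.volume_Ioc, add_sub_cancel_left, mul_comm B,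
      ENNReal.ofReal_mul (by positivity), ← ENNReal.ofReal_rpow_of_nonneg hh.le (by norm_num)]
    norm_num
  -- A = B h^(1/2) serves for both the L¹ and the L² hypothesis.
  refine (eLpNorm_fourier_sobolevMeasure_le
    (memLp_one_iff_integrable.1 (memLp_indicator_of_bound hf hB 1))
    (memLp_indicator_of_bound hf hB 2) hk hs0 hs1 hh (by positivity) h1 h2).trans
    (le_of_eq ?_)
  rw [Real.rpow_add hh]
  congr 1; ring

/-! ### Dyadic summation towards the singularity -/

theorem integrable_of_bound_rpow {f : ℝ → ℂ} {l M β : ℝ} (hf : AEStronglyMeasurable f)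
    (hβ : β < 1 / 2)
    (hb : ∀ᵐ x, ‖f x‖ ≤ (Ioo 0 l).indicator (fun x => M * x ^ (-(1 / 2) - β)) x) :
    Integrable f := by
  refine Integrable.mono' ?_ hf hb
  rw [integrable_indicator_iff measurableSet_Ioo]
  refine Integrable.const_mul ?_ M
  have := (intervalIntegral.intervalIntegrable_rpow' (a := 0) (b := l)
    (by linarith : -1 < -(1 / 2) - β)).1
  rw [← IntegrableOn]
  exact this.mono_set Ioo_subset_Ioc_self

theorem fourier_congr_ae {f g : ℝ → ℂ} (h : f =ᵐ[volume] g) : 𝓕 f = 𝓕 g :=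
  VectorFourier.fourierIntegral_congr_ae _ _ _ h

theorem fourier_add_of_integrable {f g : ℝ → ℂ} (hf : Integrable f) (hg : Integrable g) :
    𝓕 (f + g) = 𝓕 f + 𝓕 g :=
  VectorFourier.fourierIntegral_add Real.continuous_fourierChar continuous_inner hf hg

theorem hasSum_fourier_indicator {f : ℝ → ℂ} (hf : Integrable f) {S : ℕ → Set ℝ}
    (hm : ∀ j, MeasurableSet (S j)) (hd : Pairwise (Function.onFun Disjoint S))
    (hS : ∀ᵐ x, x ∉ ⋃ j, S j → f x = 0) (η : ℝ) :
    HasSum (fun j => 𝓕 ((S j).indicator f) η) (𝓕 f η) := by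
  have hint : Integrable fun x : ℝ => Real.fourierChar (-(x * η)) • f x := by
    have := (Real.fourierIntegral_convergent_iff (V := ℝ) (μ := volume) (f := f) η).2 hf
    simpa [mul_comm] using this
  have h := hasSum_integral_iUnion hm hd hint.integrableOn
  have e1 : ∀ j, ∫ x in S j, Real.fourierChar (-(x * η)) • f x = 𝓕 ((S j).indicator f) η := by
    intro j
    rw [Real.fourier_real_eq, ← integral_indicator (hm j)]
    refine integral_congr_ae (ae_of_all _ fun x => ?_)
    by_cases hx : x ∈ S j <;> simp [hx]
  have e2 : ∫ x in ⋃ j, S j, Real.fourierChar (-(x * η)) • f x = 𝓕 f η := by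
    rw [Real.fourier_real_eq, ← integral_indicator (MeasurableSet.iUnion hm)]
    refine integral_congr_ae ?_
    filter_upwards [hS] with x hx
    by_cases hx' : x ∈ ⋃ j, S j
    · rw [indicator_of_mem hx']
    · rw [indicator_of_notMem hx', hx hx', smul_zero]
  rw [← e2]
  simpa only [e1] using h

/-- The constant in `eLpNorm_fourier_le_of_bound_rpow`. -/
noncomputable def dyadicConstant (s β : ℝ) : ℝ :=
  Real.sqrt (1 + 2 / (1 - 2 * s)) / (1 - (1 / 2 : ℝ) ^ (s - β))

theorem dyadicConstant_pos {s β : ℝ} (hβs : β < s) (hs1 : s < 1 / 2) : 0 < dyadicConstant s β := by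
  have h1 : 0 < 1 - 2 * s := by linarith
  have h2 : (1 / 2 : ℝ) ^ (s - β) < 1 :=
    Real.rpow_lt_one (by norm_num) (by norm_num) (by linarith)
  have h3 := sub_pos.2 h2
  unfold dyadicConstant
  positivity

/-- The Sobolev norm of order `-1/2` of a function that is bounded by `M x^(-1/2 - β)` on `(0, l)`
and vanishes elsewhere. -/
theorem eLpNorm_fourier_le_of_bound_rpow {f : ℝ → ℂ} {k s l M β : ℝ} (hf : AEStronglyMeasurable f)
    (hk : 0 < k) (hβ0 : 0 ≤ β) (hβs : β < s) (hs1 : s < 1 / 2) (hl : 0 < l) (hM : 0 ≤ M)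
    (hb : ∀ᵐ x, ‖f x‖ ≤ (Ioo 0 l).indicator (fun x => M * x ^ (-(1 / 2) - β)) x) :
    eLpNorm (𝓕 f) 2 (sobolevMeasure k (-(1 / 2))) ≤
      ENNReal.ofReal (dyadicConstant s β * M * k ^ (s - 1 / 2) * l ^ (s - β)) := by
  have hint := integrable_of_bound_rpow hf (by linarith) hb
  set a : ℕ → ℝ := fun j => l * (1 / 2) ^ j with ha
  have ha0 : ∀ j, 0 < a j := fun j => by positivity
  have hanti : Antitone a := fun i j hij =>
    mul_le_mul_of_nonneg_left (pow_le_pow_of_le_one (by norm_num) (by norm_num) hij) hl.le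
  -- The length of each dyadic interval equals its left endpoint, so one number a (j+1) governs both
  -- the size of f and the length of the piece.
  have hsucc : ∀ j, a j = a (j + 1) + a (j + 1) := fun j => by simp only [ha, pow_succ]; ring
  have hcover : ∀ᵐ x, x ∉ ⋃ j, Ioc (a (j + 1)) (a j) → f x = 0 := by
    filter_upwards [hb] with x hx hxU
    have hx0 : x ∉ Ioo 0 l := by
      intro hxl
      obtain ⟨n, hn1, hn2⟩ := exists_nat_pow_near_of_lt_one (x := x / l) (y := (1 / 2 : ℝ))
        (div_pos hxl.1 hl) ((div_le_one hl).2 hxl.2.le) (by norm_num) (by norm_num)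
      rw [lt_div_iff₀' hl] at hn1
      rw [div_le_iff₀' hl] at hn2
      exact hxU (mem_iUnion.2 ⟨n, hn1, hn2⟩)
    rw [indicator_of_notMem hx0] at hx
    exact norm_le_zero_iff.1 hx
  have hsum := hasSum_fourier_indicator hint (S := fun j => Ioc (a (j + 1)) (a j))
    (fun j => measurableSet_Ioc) hanti.pairwise_disjoint_on_Ioc_succ hcover
  have hpiece : ∀ j, eLpNorm (𝓕 ((Ioc (a (j + 1)) (a j)).indicator f)) 2
      (sobolevMeasure k (-(1 / 2))) ≤ ENNReal.ofReal
        (Real.sqrt (1 + 2 / (1 - 2 * s)) * M * k ^ (s - 1 / 2) * l ^ (s - β) *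
          ((1 / 2 : ℝ) ^ (s - β)) ^ j) := by
    intro j
    have hB : ∀ᵐ x, x ∈ Ioc (a (j + 1)) (a (j + 1) + a (j + 1)) →
        ‖f x‖ ≤ M * a (j + 1) ^ (-(1 / 2) - β) := by
      filter_upwards [hb] with x hx hxI
      refine hx.trans (indicator_apply_le' (fun _ => ?_) fun _ => ?_)
      · exact mul_le_mul_of_nonneg_left
          (Real.rpow_le_rpow_of_nonpos (ha0 _) hxI.1.le (by linarith)) hM
      · have := ha0 (j + 1)
        positivity
    have h := eLpNorm_fourier_indicator_le hf hk (hβ0.trans_lt hβs) hs1 (ha0 (j + 1))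
      (by have := ha0 (j + 1); positivity) hB
    rw [← hsucc] at h
    refine h.trans (ENNReal.ofReal_le_ofReal ?_)
    -- The net exponent s-β is positive; this makes the series over j geometric.
    have e1 : a (j + 1) ^ (-(1 / 2) - β) * a (j + 1) ^ (s + 1 / 2) = a (j + 1) ^ (s - β) := by
      rw [← Real.rpow_add (ha0 _)]; congr 1; ring
    have e2 : a (j + 1) ^ (s - β) ≤ l ^ (s - β) * ((1 / 2 : ℝ) ^ (s - β)) ^ j := by
      have e3 : ((1 / 2 : ℝ) ^ (s - β)) ^ j = ((1 / 2 : ℝ) ^ j) ^ (s - β) := by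
        rw [← Real.rpow_natCast, ← Real.rpow_mul (by norm_num), mul_comm,
          Real.rpow_mul (by norm_num), Real.rpow_natCast]
      rw [e3, ← Real.mul_rpow hl.le (by positivity)]
      exact Real.rpow_le_rpow (ha0 _).le (hanti (Nat.le_succ j)) (by linarith)
    have hc : 0 ≤ Real.sqrt (1 + 2 / (1 - 2 * s)) * M * k ^ (s - 1 / 2) := by positivity
    calc _ = Real.sqrt (1 + 2 / (1 - 2 * s)) * M * k ^ (s - 1 / 2) *
          (a (j + 1) ^ (-(1 / 2) - β) * a (j + 1) ^ (s + 1 / 2)) := by ring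
      _ ≤ Real.sqrt (1 + 2 / (1 - 2 * s)) * M * k ^ (s - 1 / 2) *
          (l ^ (s - β) * ((1 / 2 : ℝ) ^ (s - β)) ^ j) := by
          rw [e1]; exact mul_le_mul_of_nonneg_left e2 hc
      _ = _ := by ring
  have hr1 : (1 / 2 : ℝ) ^ (s - β) < 1 :=
    Real.rpow_lt_one (by norm_num) (by norm_num) (by linarith)
  have hr0 : 0 ≤ (1 / 2 : ℝ) ^ (s - β) := by positivity
  have hpc : ∀ j, Integrable ((Ioc (a (j + 1)) (a j)).indicator f) := fun j =>
    hint.indicator measurableSet_Ioc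
  refine (eLpNorm_le_tsum_eLpNorm (fun j => (continuous_fourier (hpc j)).aestronglyMeasurable)
    (ae_of_all _ fun η => ?_)).trans ?_
  · rw [← (hsum η).tsum_eq]
    exact enorm_tsum_le_tsum_enorm
  · refine (ENNReal.tsum_le_tsum hpiece).trans (le_of_eq ?_)
    rw [← ENNReal.ofReal_tsum_of_nonneg (fun j => by positivity)
      ((summable_geometric_of_lt_one hr0 hr1).mul_left _), tsum_mul_left,
      tsum_geometric_of_lt_one hr0 hr1, dyadicConstant]
    congr 1
    ring

/-! ### Membership in the closure of the test functions -/

/-- Approximation in `L²` by smooth functions with compact support in an interval. -/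
theorem exists_schwartzMap_eLpNorm_sub_le {f : ℝ → ℂ} {l d δ : ℝ} (hd : 0 < d) (hdl : 2 * d < l)
    (hf : MemLp f 2) (hsupp : ∀ x, x ∉ Ioc d (l - d) → f x = 0) (hδ : 0 < δ) :
    ∃ φ : 𝓢(ℝ, ℂ), HasCompactSupport (φ : ℝ → ℂ) ∧ tsupport (φ : ℝ → ℂ) ⊆ Ioo 0 l ∧
      eLpNorm (f - (φ : ℝ → ℂ)) 2 volume ≤ ENNReal.ofReal δ := by
  obtain ⟨g, -, hg2, hg3⟩ := MemLp.exist_eLpNorm_sub_le (by norm_num) (by norm_num) hf hδ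
  -- χ is 1 on [d, l-d] and supported in [d/2, l-d/2]. Multiplication by χ fixes f and does not
  -- increase the error.
  let χ : ContDiffBump (l / 2) := ⟨l / 2 - d, l / 2 - d / 2, by linarith, by linarith⟩
  have hχc : HasCompactSupport fun x => (χ x : ℂ) * g x := by
    refine HasCompactSupport.mul_right ?_
    exact χ.hasCompactSupport.comp_left (g := fun y : ℝ => (y : ℂ)) rfl
  have hχd : ContDiff ℝ (⊤ : ℕ∞) fun x => (χ x : ℂ) * g x :=
    (Complex.ofRealCLM.contDiff.comp χ.contDiff).mul hg2
  refine ⟨hχc.toSchwartzMap hχd, hχc, ?_, ?_⟩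
  · have h1 : tsupport (fun x => (χ x : ℂ) * g x) ⊆ tsupport χ := by
      refine closure_mono fun x hx => ?_
      rw [Function.mem_support] at hx ⊢
      exact fun h => hx (by simp [h])
    refine h1.trans ?_
    rw [χ.tsupport_eq, Real.closedBall_eq_Icc]
    intro x hx
    have h2 : χ.rOut = l / 2 - d / 2 := rfl
    rw [h2] at hx
    constructor <;> linarith [hx.1, hx.2]
  · refine (eLpNorm_mono fun x => ?_).trans hg3
    have h3 : ((hχc.toSchwartzMap hχd : 𝓢(ℝ, ℂ)) : ℝ → ℂ) x = (χ x : ℂ) * g x := rfl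
    have h4 : (χ x : ℂ) * f x = f x := by
      by_cases hx : x ∈ Ioc d (l - d)
      · have : χ x = 1 := χ.one_of_mem_closedBall (by
          rw [Real.closedBall_eq_Icc]
          have h2 : χ.rIn = l / 2 - d := rfl
          rw [h2]
          constructor <;> linarith [hx.1, hx.2])
        simp [this]
      · simp [hsupp x hx]
    rw [Pi.sub_apply, Pi.sub_apply, h3]
    nth_rewrite 1 [← h4]
    rw [← mul_sub, norm_mul]
    refine mul_le_of_le_one_left (norm_nonneg _) ?_
    rw [Complex.norm_real, Real.norm_of_nonneg χ.nonneg]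
    exact χ.le_one

/-- The bound x^(-1/2) does not put f in L², so two end pieces of length d are cut off. Their norm
is O(d^(1/4)), by the dyadic estimate at 0 and the bounded-piece estimate at l. The bounded middle
is approximated in L², whose norm dominates the one of order -1/2. -/
theorem mem_sobolevTilde_of_bound_rpow {f : ℝ → ℂ} {l M : ℝ} (hf : AEStronglyMeasurable f)
    (hl : 0 < l) (hM : 0 ≤ M)
    (hb : ∀ᵐ x, ‖f x‖ ≤ (Ioo 0 l).indicator (fun x => M * x ^ (-(1 / 2) - 0 : ℝ)) x)
    {u : 𝓢'(ℝ, ℂ)} (hu : ∀ ψ : 𝓢(ℝ, ℂ), u ψ = ∫ x, ψ x • f x) :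
    u ∈ sobolevTilde (-(1 / 2)) (Ioo 0 l) := by
  have hint := integrable_of_bound_rpow hf (by norm_num) hb
  refine ⟨?_, fun δ hδ => ?_⟩
  · refine (sobolevNorm_le_eLpNorm_fourier hint hu 1 _).trans_lt ?_
    exact (eLpNorm_fourier_le_of_bound_rpow (s := 1 / 4) hf one_pos le_rfl (by norm_num)
      (by norm_num) hl hM hb).trans_lt ENNReal.ofReal_lt_top
  · obtain ⟨K, hK0, hK⟩ : ∃ K : ℝ, 0 ≤ K ∧ ∀ d : ℝ, 0 < d → 2 * d < l →
        eLpNorm (𝓕 ((Ioc 0 d).indicator f)) 2 (sobolevMeasure 1 (-(1 / 2))) +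
          eLpNorm (𝓕 ((Ioc (l - d) l).indicator f)) 2 (sobolevMeasure 1 (-(1 / 2))) ≤
          ENNReal.ofReal (K * d ^ (1 / 4 : ℝ)) := by
      refine ⟨dyadicConstant (1 / 4) 0 * M + Real.sqrt (1 + 2 / (1 - 2 * (1 / 4))) * M, ?_,
        fun d hd hdl => ?_⟩
      · have := dyadicConstant_pos (s := 1 / 4) (β := 0) (by norm_num) (by norm_num)
        positivity
      · have hD := dyadicConstant_pos (s := 1 / 4) (β := 0) (by norm_num) (by norm_num)
        have hb1 : ∀ᵐ x, ‖(Ioc 0 d).indicator f x‖ ≤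
            (Ioo 0 d).indicator (fun x => M * x ^ (-(1 / 2) - 0 : ℝ)) x := by
          have hne : ∀ᵐ x : ℝ, x ≠ d := by simp [ae_iff]
          filter_upwards [hb, hne] with x hx hxd
          by_cases hxI : x ∈ Ioc 0 d
          · have hxd' : x ∈ Ioo 0 d := ⟨hxI.1, lt_of_le_of_ne hxI.2 hxd⟩
            have hxl : x ∈ Ioo 0 l := ⟨hxI.1, by linarith [hxI.2]⟩
            rw [indicator_of_mem hxI, indicator_of_mem hxd']
            rwa [indicator_of_mem hxl] at hx
          · rw [indicator_of_notMem hxI, norm_zero]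
            exact indicator_nonneg (fun y hy => by have := hy.1; positivity) x
        have h1 := eLpNorm_fourier_le_of_bound_rpow (s := 1 / 4) (k := 1)
          (hf.indicator measurableSet_Ioc) one_pos le_rfl (by norm_num) (by norm_num) hd hM hb1
        -- Since 2d < l, the right end piece lies beyond d, where x^(-1/2) ≤ d^(-1/2).
        have hb2 : ∀ᵐ x, x ∈ Ioc (l - d) (l - d + d) → ‖f x‖ ≤ M * d ^ (-(1 / 2) : ℝ) := by
          filter_upwards [hb] with x hx hxI
          refine hx.trans (indicator_apply_le' (fun _ => ?_) fun _ => by positivity)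
          rw [sub_zero]
          exact mul_le_mul_of_nonneg_left
            (Real.rpow_le_rpow_of_nonpos hd (by linarith [hxI.1]) (by norm_num)) hM
        have h2 := eLpNorm_fourier_indicator_le (s := 1 / 4) (k := 1) hf one_pos (by norm_num)
          (by norm_num) hd (by positivity) hb2
        rw [sub_add_cancel] at h2
        refine (add_le_add h1 h2).trans (le_of_eq ?_)
        rw [← ENNReal.ofReal_add (by positivity) (by positivity)]
        congr 1
        have e1 : d ^ (-(1 / 2) : ℝ) * d ^ (1 / 4 + 1 / 2 : ℝ) = d ^ (1 / 4 : ℝ) := by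
          rw [← Real.rpow_add hd]; norm_num
        rw [Real.one_rpow, ← e1, sub_zero, ← e1]
        ring
    obtain ⟨δ', hδ'0, hδ'⟩ : ∃ δ' : ℝ, 0 < δ' ∧ ENNReal.ofReal δ' < δ := by
      obtain ⟨r, hr0, hr⟩ := ENNReal.lt_iff_exists_real_btwn.1 hδ
      exact ⟨r, by simpa using hr.1, hr.2⟩
    obtain ⟨d, hd0, hdl, hdδ⟩ : ∃ d : ℝ, 0 < d ∧ 2 * d < l ∧ K * d ^ (1 / 4 : ℝ) ≤ δ' / 2 := by
      have ht : Tendsto (fun d : ℝ => K * d ^ (1 / 4 : ℝ)) (𝓝[>] 0) (𝓝 0) := by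
        have h1 : ContinuousAt (fun d : ℝ => K * d ^ (1 / 4 : ℝ)) 0 :=
          continuousAt_const.mul (Real.continuousAt_rpow_const 0 _ (Or.inr (by norm_num)))
        have h2 := h1.tendsto
        rw [Real.zero_rpow (by norm_num), mul_zero] at h2
        exact h2.mono_left nhdsWithin_le_nhds
      have h1 := ht.eventually (eventually_le_nhds (half_pos hδ'0))
      have h2 : ∀ᶠ d : ℝ in 𝓝[>] 0, d ∈ Ioo 0 (l / 2) := Ioo_mem_nhdsGT (half_pos hl)
      obtain ⟨d, hd1, hd2⟩ := (h1.and h2).exists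
      exact ⟨d, hd2.1, by linarith [hd2.2], hd1⟩
    have hB : ∀ᵐ x, x ∈ Ioc d (l - d) → ‖f x‖ ≤ M * d ^ (-(1 / 2) : ℝ) := by
      filter_upwards [hb] with x hx hxI
      refine hx.trans (indicator_apply_le' (fun _ => ?_) fun _ => by positivity)
      rw [sub_zero]
      exact mul_le_mul_of_nonneg_left
        (Real.rpow_le_rpow_of_nonpos hd0 hxI.1.le (by norm_num)) hM
    obtain ⟨φ, hφ1, hφ2, hφ3⟩ := exists_schwartzMap_eLpNorm_sub_le hd0 hdl
      (memLp_indicator_of_bound hf hB 2) (fun x hx => indicator_of_notMem hx f)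
      (half_pos hδ'0)
    refine ⟨φ, hφ1, hφ2, ?_⟩
    have hmid : Integrable ((Ioc d (l - d)).indicator f - (φ : ℝ → ℂ)) :=
      (hint.indicator measurableSet_Ioc).sub φ.integrable
    have hmid2 : MemLp ((Ioc d (l - d)).indicator f - (φ : ℝ → ℂ)) 2 :=
      (memLp_indicator_of_bound hf hB 2).sub (φ.memLp 2)
    have hdec : f - (φ : ℝ → ℂ) =ᵐ[volume] ((Ioc 0 d).indicator f + (Ioc (l - d) l).indicator f) +
        ((Ioc d (l - d)).indicator f - (φ : ℝ → ℂ)) := by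
      filter_upwards [hb] with x hx
      simp only [Pi.sub_apply, Pi.add_apply]
      by_cases h0 : x ∈ Ioo 0 l
      · rcases le_or_gt x d with h1 | h1
        · simp [indicator, h0.1, h1, h1.not_gt, show ¬ (l - d < x) by linarith]
          ring
        · rcases le_or_gt x (l - d) with h2 | h2
          · simp [indicator, h1, h2, h1.not_ge, h2.not_gt]
          · simp [indicator, h1, h2, h1.not_ge, h2.not_ge, h0.2.le]
            ring
      · rw [indicator_of_notMem h0] at hx
        have hfx : f x = 0 := norm_le_zero_iff.1 hx
        simp [indicator, hfx]
    have hrepr : ∀ ψ : 𝓢(ℝ, ℂ), (u - (φ : 𝓢'(ℝ, ℂ))) ψ = ∫ x, ψ x • (f - (φ : ℝ → ℂ)) x := by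
      intro ψ
      have hψ : ∀ {h : ℝ → ℂ}, Integrable h → Integrable fun x => ψ x • h x := fun hh =>
        hh.bdd_smul _ ψ.continuous.aestronglyMeasurable
          (ae_of_all _ ψ.toBoundedContinuousFunction.norm_coe_le_norm)
      have hsub : (u - (φ : 𝓢'(ℝ, ℂ))) ψ = u ψ - (φ : 𝓢'(ℝ, ℂ)) ψ := rfl
      rw [hsub, hu, SchwartzMap.coe_apply, ← integral_sub (hψ hint) (hψ φ.integrable)]
      simp [mul_sub]
    refine lt_of_le_of_lt ?_ hδ'
    have hi0 : Integrable ((Ioc 0 d).indicator f) := hint.indicator measurableSet_Ioc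
    have hil : Integrable ((Ioc (l - d) l).indicator f) := hint.indicator measurableSet_Ioc
    refine (sobolevNorm_le_eLpNorm_fourier (hint.sub φ.integrable) hrepr 1 _).trans ?_
    rw [fourier_congr_ae hdec, fourier_add_of_integrable (hi0.add hil) hmid,
      fourier_add_of_integrable hi0 hil]
    have c0 := (continuous_fourier hi0).aestronglyMeasurable (μ := sobolevMeasure 1 (-(1 / 2)))
    have cl := (continuous_fourier hil).aestronglyMeasurable (μ := sobolevMeasure 1 (-(1 / 2)))
    have cm := (continuous_fourier hmid).aestronglyMeasurable (μ := sobolevMeasure 1 (-(1 / 2)))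
    calc _ ≤ (eLpNorm (𝓕 ((Ioc 0 d).indicator f)) 2 (sobolevMeasure 1 (-(1 / 2))) +
          eLpNorm (𝓕 ((Ioc (l - d) l).indicator f)) 2 (sobolevMeasure 1 (-(1 / 2)))) +
          eLpNorm (𝓕 ((Ioc d (l - d)).indicator f - (φ : ℝ → ℂ))) 2 (sobolevMeasure 1 (-(1 / 2))) :=
          (eLpNorm_add_le (c0.add cl) cm (by norm_num)).trans
            (add_le_add (eLpNorm_add_le c0 cl (by norm_num)) le_rfl)
      _ ≤ ENNReal.ofReal (δ' / 2) + ENNReal.ofReal (δ' / 2) := by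
          refine add_le_add ((hK d hd0 hdl).trans (ENNReal.ofReal_le_ofReal hdδ)) ?_
          exact (eLpNorm_sobolevMeasure_le_eLpNorm _).trans
            ((eLpNorm_fourier_eq hmid hmid2).trans_le hφ3)
      _ = ENNReal.ofReal δ' := by
          rw [← ENNReal.ofReal_add (half_pos hδ'0).le (half_pos hδ'0).le, add_halves]

/-! ### Piecewise polynomials as distributions -/

theorem zeroExtension_apply {Ω : Set ℝ} {f : ℝ → ℂ} (h : Integrable (Ω.indicator f))
    (ψ : 𝓢(ℝ, ℂ)) : zeroExtension Ω f ψ = ∫ x, ψ x • Ω.indicator f x := by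
  rw [zeroExtension, dif_pos h, Lp.toTemperedDistribution_apply]
  refine integral_congr_ae ?_
  filter_upwards [h.coeFn_toL1] with x hx
  rw [hx]

theorem ae_ne_meshPoint (σ l : ℝ) (n : ℕ) :
    ∀ᵐ x : ℝ, ∀ i ∈ Finset.range n, x ≠ meshPoint σ l n i := by
  rw [Finset.eventually_all]
  intro i _
  simp [ae_iff]

theorem aestronglyMeasurable_of_mem_piecewisePolynomials {σ l : ℝ} {n : ℕ} (hn : 1 ≤ n)
    {d : ℕ → ℕ} {v : ℝ → ℂ} (hv : v ∈ piecewisePolynomials σ l n d) :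
    AEStronglyMeasurable v (volume.restrict (Ioo 0 l)) := by
  set S : Set ℝ := ⋃ i : Finset.Icc 1 n, Ioo (meshPoint σ l n (i - 1)) (meshPoint σ l n i)
    with hS
  have h1 : AEStronglyMeasurable v (volume.restrict S) := by
    rw [hS, aestronglyMeasurable_iUnion_iff]
    rintro ⟨i, hi⟩
    obtain ⟨P, -, hP⟩ := hv i hi
    have hc : Continuous fun x : ℝ => P.eval (x : ℂ) :=
      P.continuous.comp Complex.continuous_ofReal
    refine hc.aestronglyMeasurable.congr ?_
    filter_upwards [ae_restrict_mem measurableSet_Ioo] with x hx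
    exact (hP x hx).symm
  refine h1.mono_measure (Measure.restrict_mono_ae ?_)
  filter_upwards [ae_ne_meshPoint σ l n] with x hx hxl
  obtain ⟨i, hi, hxi⟩ := exists_mem_meshInterval hn hxl hx
  exact mem_iUnion.2 ⟨⟨i, hi⟩, hxi⟩

theorem exists_bound_of_mem_piecewisePolynomials {σ l : ℝ} {n : ℕ} (hn : 1 ≤ n)
    {d : ℕ → ℕ} {v : ℝ → ℂ} (hv : v ∈ piecewisePolynomials σ l n d) :
    ∃ B : ℝ, 0 ≤ B ∧ ∀ᵐ x, x ∈ Ioo 0 l → ‖v x‖ ≤ B := by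
  have hB : ∀ i, ∃ B : ℝ, 0 ≤ B ∧ (i ∈ Finset.Icc 1 n → ∀ x ∈ Ioo 0 l,
      x ∈ Ioo (meshPoint σ l n (i - 1)) (meshPoint σ l n i) → ‖v x‖ ≤ B) := by
    intro i
    by_cases hi : i ∈ Finset.Icc 1 n
    · obtain ⟨P, -, hP⟩ := hv i hi
      have hc : Continuous fun x : ℝ => P.eval (x : ℂ) :=
        P.continuous.comp Complex.continuous_ofReal
      obtain ⟨B, hB⟩ := (isCompact_Icc (a := (0 : ℝ)) (b := l)).exists_bound_of_continuousOn
        hc.continuousOn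
      exact ⟨|B|, abs_nonneg _, fun _ x hx hxi =>
        (hP x hxi ▸ hB x (Ioo_subset_Icc_self hx)).trans (le_abs_self B)⟩
    · exact ⟨0, le_rfl, fun h => absurd h hi⟩
  choose B hB0 hB using hB
  refine ⟨∑ i ∈ Finset.Icc 1 n, B i, Finset.sum_nonneg fun i _ => hB0 i, ?_⟩
  filter_upwards [ae_ne_meshPoint σ l n] with x hx hxl
  obtain ⟨i, hi, hxi⟩ := exists_mem_meshInterval hn hxl hx
  exact (hB i hi x hxl hxi).trans (Finset.single_le_sum (fun i _ => hB0 i) hi)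

theorem aestronglyMeasurable_indicator_sub {g : ℂ → ℂ}
    (hg : AnalyticOnNhd ℂ g {z : ℂ | 0 < z.re}) {σ l : ℝ} {n : ℕ} (hn : 1 ≤ n)
    {d : ℕ → ℕ} {v : ℝ → ℂ} (hv : v ∈ piecewisePolynomials σ l n d) :
    AEStronglyMeasurable ((Ioo 0 l).indicator fun x : ℝ => g (x : ℂ) - v x) := by
  rw [aestronglyMeasurable_indicator_iff measurableSet_Ioo]
  refine AEStronglyMeasurable.sub ?_ (aestronglyMeasurable_of_mem_piecewisePolynomials hn hv)
  refine ContinuousOn.aestronglyMeasurable ?_ measurableSet_Ioo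
  exact hg.continuousOn.comp Complex.continuous_ofReal.continuousOn fun x hx => by
    simpa using hx.1

/-- The functions `g - v` belong to `H̃^(-1/2)(0, l)`. -/
theorem integrableOn_and_zeroExtension_mem_sobolevTilde {g : ℂ → ℂ} {Chat : ℝ} (hC : 0 ≤ Chat)
    (hg : AnalyticOnNhd ℂ g {z : ℂ | 0 < z.re})
    (hgb : ∀ z : ℂ, 0 < z.re → ‖g z‖ ≤ Chat * ‖z‖ ^ (-(1 / 2) : ℝ))
    {σ l : ℝ} (hl : 0 < l) {n : ℕ} (hn : 1 ≤ n) {d : ℕ → ℕ} {v : ℝ → ℂ}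
    (hv : v ∈ piecewisePolynomials σ l n d) :
    IntegrableOn (fun x : ℝ => g (x : ℂ) - v x) (Ioo 0 l) ∧
      zeroExtension (Ioo 0 l) (fun x : ℝ => g (x : ℂ) - v x) ∈
        sobolevTilde (-(1 / 2)) (Ioo 0 l) := by
  obtain ⟨B, hB0, hB⟩ := exists_bound_of_mem_piecewisePolynomials hn hv
  have hmeas := aestronglyMeasurable_indicator_sub hg hn hv
  -- The bound B for v is absorbed into the singular bound, because 1 ≤ l^(1/2) x^(-1/2) on (0, l).
  have hM : 0 ≤ Chat + B * l ^ (1 / 2 : ℝ) := by positivity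
  have hb : ∀ᵐ x, ‖(Ioo 0 l).indicator (fun x : ℝ => g (x : ℂ) - v x) x‖ ≤
      (Ioo 0 l).indicator (fun x => (Chat + B * l ^ (1 / 2 : ℝ)) * x ^ (-(1 / 2) - 0 : ℝ)) x := by
    filter_upwards [hB] with x hx
    by_cases hxl : x ∈ Ioo 0 l
    · rw [indicator_of_mem hxl, indicator_of_mem hxl, sub_zero, add_mul]
      have hx0 : 0 < x := hxl.1
      refine (norm_sub_le _ _).trans (add_le_add ?_ ?_)
      · simpa [abs_of_pos hx0] using hgb x (by simpa using hx0)
      · refine (hx hxl).trans ?_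
        rw [mul_assoc]
        refine le_mul_of_one_le_right hB0 ?_
        calc (1 : ℝ) = x ^ (1 / 2 : ℝ) * x ^ (-(1 / 2) : ℝ) := by
              rw [← Real.rpow_add hx0]; norm_num
          _ ≤ _ := by
              gcongr
              exact hxl.2.le
    · rw [indicator_of_notMem hxl, indicator_of_notMem hxl, norm_zero]
  have hint := integrable_of_bound_rpow hmeas (by norm_num) hb
  exact ⟨(integrable_indicator_iff measurableSet_Ioo).1 hint,
    mem_sobolevTilde_of_bound_rpow hmeas hl hM hb (zeroExtension_apply hint)⟩

/-! ### Combining the two estimates -/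

/-- The error of the best approximation for a given rate `τ`. -/
theorem iInf_sobolevNorm_le {σ α ε c τ k l Chat : ℝ} (hσ0 : 0 < σ) (hσ1 : σ < 1)
    (hα : α ∈ Icc (0 : ℝ) 1) (hε0 : 0 < ε) (hε1 : ε < 1 / 2) (hτ0 : 0 ≤ τ)
    (hτσ : τ ≤ -Real.log (1 - σ)) (hτc : τ ≤ ε / 2 * -Real.log σ * c) (hk : 0 < k) (hl : 0 < l)
    (hC : 0 ≤ Chat) {g : ℂ → ℂ} (hg : AnalyticOnNhd ℂ g {z : ℂ | 0 < z.re})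
    (hgb : ∀ z : ℂ, 0 < z.re → ‖g z‖ ≤ Chat * ‖z‖ ^ (-(1 / 2) : ℝ))
    {n p : ℕ} (hn : 1 ≤ n) (hcp : c * (p : ℝ) ≤ n) :
    (⨅ v ∈ piecewisePolynomials σ l n (degreeVector α p n),
      sobolevNorm k (-(1 / 2)) (zeroExtension (Ioo 0 l) fun x : ℝ => g (x : ℂ) - v x)) ≤
    ENNReal.ofReal (dyadicConstant ε (ε / 2) *
      ((σ / 2) ^ (-(1 / 2) : ℝ) / σ * σ ^ (-(ε / 2))) * Chat * k ^ (-(1 / 2) : ℝ) *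
        (k * l) ^ ε * Real.exp (-(p * τ))) := by
  obtain ⟨v, hv, hvb⟩ := exists_piecewisePolynomial_approx hσ0 hσ1 hα (half_pos hε0).le hτ0 hτσ
    hτc hl hC hg hgb hn hcp
  refine (iInf₂_le v hv).trans ?_
  have hmeas := aestronglyMeasurable_indicator_sub hg hn hv
  set K := (σ / 2) ^ (-(1 / 2) : ℝ) / σ * σ ^ (-(ε / 2)) with hK
  have hb : ∀ᵐ x, ‖(Ioo 0 l).indicator (fun x : ℝ => g (x : ℂ) - v x) x‖ ≤
      (Ioo 0 l).indicator (fun x => K * (Chat * Real.exp (-(p * τ)) * l ^ (ε / 2)) *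
        x ^ (-(1 / 2) - ε / 2)) x := by
    filter_upwards [ae_ne_meshPoint σ l n] with x hx
    by_cases hxl : x ∈ Ioo 0 l
    · rw [indicator_of_mem hxl, indicator_of_mem hxl]
      exact hvb x hxl hx
    · rw [indicator_of_notMem hxl, indicator_of_notMem hxl, norm_zero]
  have hint := integrable_of_bound_rpow hmeas (by linarith) hb
  refine (sobolevNorm_le_eLpNorm_fourier hint (zeroExtension_apply hint) k _).trans ?_
  -- With s = ε and β = ε/2, a positive β supplies the exponential rate and a positive s-β the
  -- convergence of the dyadic sum. The factors l^β and l^(s-β) recombine to l^ε.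
  refine (eLpNorm_fourier_le_of_bound_rpow (s := ε) hmeas hk (half_pos hε0).le (by linarith) hε1 hl
    (by positivity) hb).trans (le_of_eq ?_)
  congr 1
  have e1 : l ^ ε = l ^ (ε / 2) * l ^ (ε - ε / 2) := by
    rw [← Real.rpow_add hl]; congr 1; ring
  rw [Real.mul_rpow hk.le hl.le, e1, sub_eq_add_neg ε (1 / 2 : ℝ), Real.rpow_add hk]
  ring

end HalfPlane

theorem theorem5p5 (σ : ℝ) (hσ0 : 0 < σ) (hσ1 : σ < 1) :
    -- the constant `C` depends only on `σ` and `ε`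
    ∃ C : ℝ → ℝ, (∀ ε ∈ Ioo (0 : ℝ) (1 / 2), 0 < C ε) ∧
      Tendsto C (𝓝[>] 0) atTop ∧ Tendsto C (𝓝[<] (1 / 2)) atTop ∧
      ∀ α ∈ Icc (0 : ℝ) 1, ∀ c : ℝ, 0 < c →
        -- the constant `τ` depends only on `σ`, `α`, `c` and `ε`
        ∃ τ : ℝ → ℝ, (∀ ε ∈ Ioo (0 : ℝ) (1 / 2), 0 < τ ε) ∧
          Tendsto τ (𝓝[>] 0) (𝓝 0) ∧
          ∀ ε ∈ Ioo (0 : ℝ) (1 / 2), ∀ (k l Chat : ℝ), 0 < k → 0 < l → 0 < Chat →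
            ∀ g : ℂ → ℂ, AnalyticOnNhd ℂ g {z : ℂ | 0 < z.re} →
              (∀ z : ℂ, 0 < z.re → ‖g z‖ ≤ Chat * ‖z‖ ^ (-(1 / 2) : ℝ)) →
              ∀ n p : ℕ, 1 ≤ n → c * (p : ℝ) ≤ (n : ℝ) →
                (∀ v ∈ HalfPlane.piecewisePolynomials σ l n (HalfPlane.degreeVector α p n),
                  IntegrableOn (fun x : ℝ => g (x : ℂ) - v x) (Ioo 0 l) ∧
                  HalfPlane.zeroExtension (Ioo 0 l) (fun x : ℝ => g (x : ℂ) - v x) ∈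
                    HalfPlane.sobolevTilde (-(1 / 2)) (Ioo 0 l)) ∧
                (⨅ v ∈ HalfPlane.piecewisePolynomials σ l n (HalfPlane.degreeVector α p n),
                    HalfPlane.sobolevNorm k (-(1 / 2))
                      (HalfPlane.zeroExtension (Ioo 0 l) (fun x : ℝ => g (x : ℂ) - v x))) ≤
                  ENNReal.ofReal (C ε * Chat * k ^ (-(1 / 2) : ℝ) * (k * l) ^ ε *
                    Real.exp (-((p : ℝ) * τ ε))) := by
  have hlogσ : 0 < -Real.log σ := by
    have := Real.log_neg hσ0 hσ1
    linarith
  have hlogσ' : 0 < -Real.log (1 - σ) := by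
    have := Real.log_neg (sub_pos.2 hσ1) (by linarith)
    linarith
  set C₀ : ℝ → ℝ := fun ε => HalfPlane.dyadicConstant ε (ε / 2) *
    ((σ / 2) ^ (-(1 / 2) : ℝ) / σ * σ ^ (-(ε / 2))) with hC₀
  have hC₀pos : ∀ ε ∈ Ioo (0 : ℝ) (1 / 2), 0 < C₀ ε := by
    intro ε hε
    have := HalfPlane.dyadicConstant_pos (s := ε) (β := ε / 2) (by linarith [hε.1]) hε.2
    positivity
  have hlim0 : Tendsto (fun ε : ℝ => ε⁻¹) (𝓝[>] 0) atTop := tendsto_inv_nhdsGT_zero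
  have hlim1 : Tendsto (fun ε : ℝ => (1 / 2 - ε)⁻¹) (𝓝[<] (1 / 2)) atTop := by
    refine tendsto_inv_nhdsGT_zero.comp (tendsto_nhdsWithin_iff.2 ⟨?_, ?_⟩)
    · have h : Tendsto (fun ε : ℝ => 1 / 2 - ε) (𝓝 (1 / 2)) (𝓝 (1 / 2 - 1 / 2)) :=
        (continuous_const.sub continuous_id).tendsto _
      rw [sub_self] at h
      exact h.mono_left nhdsWithin_le_nhds
    · filter_upwards [self_mem_nhdsWithin] with ε hε
      exact sub_pos.2 (mem_Iio.1 hε)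
  -- The two reciprocals enlarge the constant so that its divergence at both endpoints is immediate.
  refine ⟨fun ε => C₀ ε + ε⁻¹ + (1 / 2 - ε)⁻¹, fun ε hε => ?_, ?_, ?_, fun α hα c hc => ?_⟩
  · have h1 := hC₀pos ε hε
    have h2 := inv_pos.2 hε.1
    have h3 := inv_pos.2 (sub_pos.2 hε.2)
    positivity
  · refine tendsto_atTop_mono' _ ?_ hlim0
    filter_upwards [Ioo_mem_nhdsGT (by norm_num : (0 : ℝ) < 1 / 2)] with ε hε
    have h1 := hC₀pos ε hε
    have h3 := inv_pos.2 (sub_pos.2 hε.2)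
    linarith
  · refine tendsto_atTop_mono' _ ?_ hlim1
    filter_upwards [Ioo_mem_nhdsLT (by norm_num : (0 : ℝ) < 1 / 2)] with ε hε
    have h1 := hC₀pos ε hε
    have h2 := inv_pos.2 hε.1
    linarith
  -- τ is the smaller of the Taylor rate and the mesh rate. One choice works for all α in [0, 1],
  -- and the mesh rate forces τ → 0 as ε → 0.
  · refine ⟨fun ε => min (-Real.log (1 - σ)) (ε / 2 * -Real.log σ * c), fun ε hε => ?_, ?_, ?_⟩
    · have := hε.1
      exact lt_min hlogσ' (by positivity)
    · have h : ContinuousAt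
          (fun ε : ℝ => min (-Real.log (1 - σ)) (ε / 2 * -Real.log σ * c)) 0 := by fun_prop
      have h2 := h.tendsto
      rw [zero_div, zero_mul, zero_mul, min_eq_right hlogσ'.le] at h2
      exact h2.mono_left nhdsWithin_le_nhds
    · intro ε hε k l Chat hk hl hChat g hg hgb n p hn hcp
      refine ⟨fun v hv => HalfPlane.integrableOn_and_zeroExtension_mem_sobolevTilde hChat.le hg hgb
        hl hn hv, ?_⟩
      have hτ0 : 0 ≤ min (-Real.log (1 - σ)) (ε / 2 * -Real.log σ * c) := by
        have := hε.1
        exact le_min hlogσ'.le (by positivity)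
      refine (HalfPlane.iInf_sobolevNorm_le hσ0 hσ1 hα hε.1 hε.2 hτ0 (min_le_left _ _)
        (min_le_right _ _) hk hl hChat.le hg hgb hn hcp).trans (ENNReal.ofReal_le_ofReal ?_)
      have h2 := inv_pos.2 hε.1
      have h3 := inv_pos.2 (sub_pos.2 hε.2)
      gcongr
      linarith
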